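/- **Theorem 1 (Characterization of target circuits via gauges).** Let $0\le k\le n$. For $v=(r,r')\in\mathbb F_2^{2n}$ write $P_v=X^{r}Z^{r'}$ for the corresponding $n$-qubit Pauli operator; the Pauli group $\mathcal P^n$ consists of all $\mathrm i^q P_v$ with $q\in\{0,1,2,3\}$, and the Clifford group $\mathcal C^n$ is its normalizer in $\mathrm U(2^n)$. A matrix $A$ in $\operatorname{Sp}(\mathbb F_2^{2n})=\{A : A^{T}\left[\begin{smallmatrix}0&\mathbb 1\\ \mathbb 1&0\end{smallmatrix}\right]A=\left[\begin{smallmatrix}0&\mathbb 1\\ \mathbb 1&0\end{smallmatrix}\right]\}$ *represents* $U\in\mathcal C^n$ if $UP_vU^\dagger\propto P_{Av}$ for all $v\in\mathbb F_2^{2n}$. Let $\mathcal L\subset(\mathbb C^2)^{\otimes n}$ be an $[[n,k,d]]$ stabilizer code (of any distance $d$), i.e. the common $+1$-eigenspace of $n-k$ commuting, independent, Hermitian Pauli operators, and let $U_E\in\mathcal C^n$ be a Clifford encoding operation for it, i.e. $\mathcal L=\{U_E(|\psi\rangle\otimes|0\rangle^{\otimes(n-k)}) : |\psi\rangle\in(\mathbb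 C^2)^{\otimes k}\}$, represented by $E\in\operatorname{Sp}(\mathbb F_2^{2n})$. Let $U_C\in\mathcal C^k$, and let $C'\in\operatorname{Sp}(\mathbb F_2^{2n})$ represent $U_C\otimes\mathbb 1_{n-k}$. Say that $U\in\mathcal C^n$ *implements $U_C$ on the logical level* if there is a phase $c\in\mathbb C$, $|c|=1$, with $U\,U_E(|\psi\rangle\otimes|0\rangle^{\otimes(n-k)})=c\,U_E(U_C|\psi\rangle\otimes|0\rangle^{\otimes(n-k)})$ for all $|\psi\rangle\in(\mathbb C^2)^{\otimes k}$. Let $\mathcal F$ be the set of all $F\in\operatorname{Sp}(\mathbb F_2^{2n})$ of the block form (block rows and columns of sizes $k,\,n-k,\,k,\,n-k$) $$F=\begin{bmatrix}\mathbb 1&*&0&0\\ 0&*&0&0\\ 0&*&\mathbb 1&0\\ *&*&*&*\end{bmatrix},$$ where the entries $*$ are constrained only by $F\in\operatorname{Sp}(\mathbb F_2^{2n})$. Then: 1. every $U\in\mathcal C^n$ that implements $U_C$ on the logical level is represented by $EC'FE^{-1}$ for exactly one $F\in\mathcal F$; 2. conversely, for every $F\in\mathcal F$ there is a $U\in\mathcal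 C^n$ that is represented by $EC'FE^{-1}$ and implements $U_C$ on the logical level; 3. $\mathcal F$ is a group under matrix multiplication; 4. $$|\mathcal F|=\frac{2^{n(n+1)/2+k(n-k)}}{2^{k(k+1)/2}}\prod_{m=1}^{n-k}\left(2^{n-k}-2^{m-1}\right).$$ -/

import Mathlib

open Matrix

/-- Computational basis labels of `n` qubits (bit strings). The state space `(ℂ²)^{⊗ n}` is
`Bits n → ℂ`, and linear operators on it are matrices indexed by `Bits n`. -/
abbrev Bits (n : ℕ) : Type := Fin n → ZMod 2

/-- The group `U(2^n)` of `n`-qubit unitaries. -/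
abbrev QUnitary (n : ℕ) : Type := Matrix.unitaryGroup (Bits n) ℂ

/-- The binary symplectic group `Sp(𝔽₂^{2n})`. In the index type `Fin n ⊕ Fin n` the left summand
carries the `X`-part and the right summand the `Z`-part. (In characteristic two `-1 = 1`, so the
defining form of `Matrix.symplecticGroup` is the block matrix with rows `0 1` and `1 0`.) -/
abbrev Sp (n : ℕ) : Type := Matrix.symplecticGroup (Fin n) (ZMod 2)

/-- `X^r = X^{r₁} ⊗ ⋯ ⊗ X^{rₙ}`, that is, `X^r |y⟩ = |y + r⟩`. -/
def pauliX {n : ℕ} (r : Bits n) : Matrix (Bits n) (Bits n) ℂ :=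
  Matrix.of fun x y => if x = y + r then 1 else 0

/-- `Z^s = Z^{s₁} ⊗ ⋯ ⊗ Z^{sₙ}`, that is, `Z^s |y⟩ = (-1)^{s·y} |y⟩`. -/
def pauliZ {n : ℕ} (s : Bits n) : Matrix (Bits n) (Bits n) ℂ :=
  Matrix.diagonal fun y => (-1 : ℂ) ^ (s ⬝ᵥ y).val

/-- The Pauli operator `X^r Z^s` with binary representation `v = (r, s)`. -/
def pauliOp {n : ℕ} (v : Fin n ⊕ Fin n → ZMod 2) : Matrix (Bits n) (Bits n) ℂ :=
  pauliX (fun i => v (Sum.inl i)) * pauliZ (fun i => v (Sum.inr i))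

theorem negOnePow_val_add (a b : ZMod 2) :
    (-1 : ℂ) ^ (a + b).val = (-1) ^ a.val * (-1) ^ b.val := by
  rw [← pow_add, ZMod.val_add, neg_one_pow_eq_pow_mod_two, Nat.mod_mod,
    ← neg_one_pow_eq_pow_mod_two]

theorem pauliOp_apply {n : ℕ} (v : Fin n ⊕ Fin n → ZMod 2) (x y : Bits n) :
    pauliOp v x y = if x = y + (fun i => v (Sum.inl i))
      then (-1 : ℂ) ^ ((fun i => v (Sum.inr i)) ⬝ᵥ y).val else 0 := by
  simp [pauliOp, pauliX, pauliZ, Matrix.mul_diagonal]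

theorem pauliOp_mul {n : ℕ} (v w : Fin n ⊕ Fin n → ZMod 2) :
    pauliOp v * pauliOp w =
      (-1 : ℂ) ^ ((fun i => v (Sum.inr i)) ⬝ᵥ (fun i => w (Sum.inl i))).val • pauliOp (v + w) := by
  ext x y
  rw [Matrix.mul_apply, Finset.sum_eq_single (y + fun i => w (Sum.inl i))]
  · have h1 : (y + fun i => (v + w) (Sum.inl i))
        = y + (fun i => w (Sum.inl i)) + (fun i => v (Sum.inl i)) := by
      ext i; simp [Pi.add_apply]; ring
    have h2 : ((fun i => (v + w) (Sum.inr i)) : Bits n)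
        = (fun i => v (Sum.inr i)) + (fun i => w (Sum.inr i)) := rfl
    rw [Matrix.smul_apply, pauliOp_apply, pauliOp_apply, pauliOp_apply, h1, h2,
      add_dotProduct, dotProduct_add, negOnePow_val_add, negOnePow_val_add]
    rw [if_pos rfl]
    split_ifs <;> simp
    ring
  · intro z _ hz
    rw [pauliOp_apply w, if_neg hz, mul_zero]
  · simp

theorem pauliOp_zero {n : ℕ} : pauliOp (0 : Fin n ⊕ Fin n → ZMod 2) = 1 := by
  ext x y
  have h : ((fun _ => 0) : Bits n) = 0 := rfl
  simp [pauliOp_apply, Matrix.one_apply, h]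

/-- The `n`-qubit Pauli group, consisting of all `i^q X^r Z^s`. -/
def pauliGroup (n : ℕ) : Subgroup (QUnitary n) where
  carrier := {U | ∃ (q : ℕ) (v : Fin n ⊕ Fin n → ZMod 2),
    (U : Matrix (Bits n) (Bits n) ℂ) = Complex.I ^ q • pauliOp v}
  one_mem' := ⟨0, 0, by simp [pauliOp_zero]⟩
  mul_mem' := by
    rintro U V ⟨p, v, hU⟩ ⟨q, w, hV⟩
    refine ⟨p + q + 2 * ((fun i => v (Sum.inr i)) ⬝ᵥ (fun i => w (Sum.inl i))).val, v + w, ?_⟩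
    rw [Submonoid.coe_mul, hU, hV, smul_mul_smul_comm, pauliOp_mul, smul_smul, pow_add, pow_add,
      pow_mul Complex.I 2, Complex.I_sq]
  inv_mem' := by
    rintro U ⟨q, v, hU⟩
    refine ⟨3 * q + 2 * ((fun i => v (Sum.inr i)) ⬝ᵥ (fun i => v (Sum.inl i))).val, v, ?_⟩
    have hv : v + v = 0 := by ext i; exact CharTwo.add_self_eq_zero _
    set a := ((fun i => v (Sum.inr i)) ⬝ᵥ (fun i => v (Sum.inl i))).val with ha
    have key : (U : Matrix (Bits n) (Bits n) ℂ)
        * (Complex.I ^ (3 * q + 2 * a) • pauliOp v) = 1 := by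
      rw [hU, smul_mul_smul_comm, pauliOp_mul, smul_smul, ← ha, hv, pauliOp_zero, pow_add,
        pow_mul Complex.I 2, Complex.I_sq]
      have : Complex.I ^ q * (Complex.I ^ (3 * q) * (-1) ^ a) * (-1) ^ a
          = (Complex.I ^ 4) ^ q * ((-1) ^ 2) ^ a := by
        rw [← pow_mul, ← pow_mul]; ring
      rw [this]; simp
    have h1 : ((U⁻¹ : QUnitary n) : Matrix (Bits n) (Bits n) ℂ) * U = 1 := by
      rw [← Submonoid.coe_mul, inv_mul_cancel, Submonoid.coe_one]
    exact left_inv_eq_right_inv h1 key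

/-- The `n`-qubit Clifford group: the normalizer of the Pauli group in `U(2^n)`. -/
def cliffordGroup (n : ℕ) : Subgroup (QUnitary n) :=
  Subgroup.normalizer (pauliGroup n : Set (QUnitary n))

/-- The symplectic matrix `A` represents the operator `U`: conjugation by `U` sends the Pauli
operator with binary vector `v` to a multiple of the one with binary vector `A v`. -/
def SympRepresents {n : ℕ} (U : Matrix (Bits n) (Bits n) ℂ) (A : Sp n) : Prop :=
  ∀ v : Fin n ⊕ Fin n → ZMod 2, ∃ c : ℂ, c ≠ 0 ∧
    U * pauliOp v * Uᴴ =
      c • pauliOp ((A : Matrix (Fin n ⊕ Fin n) (Fin n ⊕ Fin n) (ZMod 2)) *ᵥ v)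

/-- The subspace `L` is an `n`-qubit stabilizer code with `k` logical qubits: the common
`+1`-eigenspace of `n - k` commuting, independent, Hermitian Pauli operators
`S_j = i^{q_j} X^{r_j} Z^{s_j}` with `v_j = (r_j, s_j)`. -/
def IsStabilizerCode (n k : ℕ) (L : Submodule ℂ (Bits n → ℂ)) : Prop :=
  ∃ (q : Fin (n - k) → ℕ) (v : Fin (n - k) → (Fin n ⊕ Fin n → ZMod 2)),
    (∀ j, (Complex.I ^ q j • pauliOp (v j)).IsHermitian) ∧
    (∀ i j, Commute (Complex.I ^ q i • pauliOp (v i)) (Complex.I ^ q j • pauliOp (v j))) ∧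
    LinearIndependent (ZMod 2) v ∧
    ∀ ψ : Bits n → ℂ, ψ ∈ L ↔ ∀ j, (Complex.I ^ q j • pauliOp (v j)) *ᵥ ψ = ψ

/-- The bits of the first `k` of `n` qubits. -/
def firstBits {n k : ℕ} (hk : k ≤ n) (x : Bits n) : Bits k := fun i => x (Fin.castLE hk i)

/-- `V ⊗ 1`, the `k`-qubit operator `V` acting on the first `k` of `n` qubits. -/
def tensorOne {n k : ℕ} (hk : k ≤ n) (V : Matrix (Bits k) (Bits k) ℂ) :
    Matrix (Bits n) (Bits n) ℂ :=
  Matrix.of fun x y =>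
    if ∀ j : Fin n, k ≤ (j : ℕ) → x j = y j then V (firstBits hk x) (firstBits hk y) else 0

/-- `|ψ⟩ ⊗ |0⟩^{⊗ (n - k)}`. -/
def tensorZero {n k : ℕ} (hk : k ≤ n) (ψ : Bits k → ℂ) : Bits n → ℂ := fun x =>
  if ∀ j : Fin n, k ≤ (j : ℕ) → x j = 0 then ψ (firstBits hk x) else 0

/-- The logical state vector `U_E (|ψ⟩ ⊗ |0⟩^{⊗ (n - k)})` that the encoding operation `UE`
assigns to the `k`-qubit state vector `ψ`. -/
def encode {n k : ℕ} (hk : k ≤ n) (UE : QUnitary n) (ψ : Bits k → ℂ) : Bits n → ℂ :=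
  (UE : Matrix (Bits n) (Bits n) ℂ) *ᵥ tensorZero hk ψ

/-- `UE` is an encoding operation for the code `L`: the logical state vectors are exactly the
elements of `L`. -/
def IsEncoder {n k : ℕ} (hk : k ≤ n) (L : Submodule ℂ (Bits n → ℂ)) (UE : QUnitary n) : Prop :=
  (L : Set (Bits n → ℂ)) = Set.range (encode hk UE)

/-- `U` implements the `k`-qubit gate `UC` on the logical level of the code encoded by `UE`:
up to a global phase, it sends the logical state of `ψ` to that of `UC ψ`. -/
def Implements {n k : ℕ} (hk : k ≤ n) (UE : QUnitary n) (UC : QUnitary k) (U : QUnitary n) :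
    Prop :=
  ∃ c : ℂ, ‖c‖ = 1 ∧ ∀ ψ : Bits k → ℂ,
    (U : Matrix (Bits n) (Bits n) ℂ) *ᵥ encode hk UE ψ
      = c • encode hk UE ((UC : Matrix (Bits k) (Bits k) ℂ) *ᵥ ψ)

/-- The block shape of a freedom matrix, where `*` is arbitrary and block rows and block columns
have sizes `k, n - k, k, n - k`:
```
  1 * 0 0
  0 * 0 0
  0 * 1 0
  * * * *
```
-/
structure HasFreedomShape {n : ℕ} (k : ℕ)
    (F : Matrix (Fin n ⊕ Fin n) (Fin n ⊕ Fin n) (ZMod 2)) : Prop where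
  xx : ∀ i j : Fin n, (j : ℕ) < k → F (Sum.inl i) (Sum.inl j) = if i = j then 1 else 0
  xz : ∀ i j : Fin n, F (Sum.inl i) (Sum.inr j) = 0
  zx : ∀ i j : Fin n, (i : ℕ) < k → (j : ℕ) < k → F (Sum.inr i) (Sum.inl j) = 0
  zz : ∀ i j : Fin n, (i : ℕ) < k → F (Sum.inr i) (Sum.inr j) = if i = j then 1 else 0

/-- The set of freedom matrices: the symplectic matrices with the freedom shape. -/
def freedomSet (n k : ℕ) : Set (Sp n) :=
  {F | HasFreedomShape k (F : Matrix (Fin n ⊕ Fin n) (Fin n ⊕ Fin n) (ZMod 2))}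

/-! Everything reduces to the trivial gate. Let V = U_C ⊗ 1 and let H₀ be the space of the states
|ψ⟩ ⊗ |0⟩. Then U implements U_C exactly when W = V⁻¹ U_E⁻¹ U U_E acts on H₀ as a phase, and E C' F
E⁻¹ represents U exactly when F represents W. It remains to see that the freedom matrices are those
representing Clifford operators that act as a phase on H₀.

The operators P_v whose X-part lives on the first k qubits preserve H₀, and a Z-part on the other
qubits is invisible there. The freedom shape says precisely that F changes each such v only by an
invisible Z-part (`hasFreedomShape_iff`). If W is a phase on H₀, then restricting W P_v = a P_{Fv} W
to H₀ gives P_v = a P_{Fv} there, which forces the shape (`IsScalarOnFirst.mem_freedomSet`).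

Conversely, `exists_unitary_conj_pauliOp` yields a unitary W with W P_v W† = i^{q(v)} P_{Fv}, where
q lifts a binary quadratic form that vanishes on the v above. Hence W† and P_v commute when applied
to H₀. The Z-type P_v make W†|0⟩ a multiple of |0⟩, and the X-type ones carry the same scalar to all
of H₀ (`exists_isScalarOnFirst`).

For the count, F has blocks P, 0, Q, (Pᵀ)⁻¹. Here P = [1 a; 0 g] with g invertible, and S = PᵀQ is
any symmetric matrix with zero leading k × k block, chosen independently of P (`freedomEquiv`). -/

/-! ### Pauli operators: products, adjoints, traces, Schur's lemma -/

theorem zmodTwo_fun_add_self {ι : Type*} (f : ι → ZMod 2) : f + f = 0 :=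
  funext fun _ => CharTwo.add_self_eq_zero _

/-- The bilinear form governing multiplication of Pauli operators. -/
def pauliForm {n : ℕ} (v w : Fin n ⊕ Fin n → ZMod 2) : ZMod 2 :=
  (fun i => v (Sum.inr i)) ⬝ᵥ (fun i => w (Sum.inl i))

/-- The sign `(-1)^a` of a bit. -/
def bitSign (a : ZMod 2) : ℂ := (-1) ^ a.val

theorem bitSign_add (a b : ZMod 2) : bitSign (a + b) = bitSign a * bitSign b :=
  negOnePow_val_add a b

@[simp] theorem bitSign_zero : bitSign 0 = 1 := by simp [bitSign]

@[simp] theorem bitSign_one : bitSign 1 = -1 := by simp [bitSign, ZMod.val_one]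

@[simp] theorem bitSign_mul_self (a : ZMod 2) : bitSign a * bitSign a = 1 := by
  rw [← bitSign_add, CharTwo.add_self_eq_zero, bitSign_zero]

theorem bitSign_ne_zero (a : ZMod 2) : bitSign a ≠ 0 := by simp [bitSign]

theorem star_bitSign (a : ZMod 2) : star (bitSign a) = bitSign a := by simp [bitSign]

theorem bitSign_injective : Function.Injective bitSign := by
  have h : ∀ a : ZMod 2, a = 0 ∨ a = 1 := by decide
  have h2 : (1 : ℂ) ≠ -1 := by norm_num
  intro a b hab
  rcases h a with rfl | rfl <;> rcases h b with rfl | rfl <;> simp_all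

theorem pauliOp_mul_eq {n : ℕ} (v w : Fin n ⊕ Fin n → ZMod 2) :
    pauliOp v * pauliOp w = bitSign (pauliForm v w) • pauliOp (v + w) :=
  pauliOp_mul v w

theorem pauliOp_add {n : ℕ} (v w : Fin n ⊕ Fin n → ZMod 2) :
    pauliOp (v + w) = bitSign (pauliForm v w) • (pauliOp v * pauliOp w) := by
  rw [pauliOp_mul_eq, smul_smul, bitSign_mul_self, one_smul]

theorem pauliOp_mul_self {n : ℕ} (v : Fin n ⊕ Fin n → ZMod 2) :
    pauliOp v * pauliOp v = bitSign (pauliForm v v) • 1 := by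
  rw [pauliOp_mul_eq, zmodTwo_fun_add_self, pauliOp_zero]

theorem pauliOp_commutation {n : ℕ} (v w : Fin n ⊕ Fin n → ZMod 2) :
    pauliOp v * pauliOp w = bitSign (pauliForm v w + pauliForm w v) • (pauliOp w * pauliOp v) := by
  rw [pauliOp_mul_eq, pauliOp_mul_eq, smul_smul, bitSign_add, mul_assoc, bitSign_mul_self, mul_one,
    add_comm v w]

theorem pauliOp_conjTranspose {n : ℕ} (v : Fin n ⊕ Fin n → ZMod 2) :
    (pauliOp v)ᴴ = bitSign (pauliForm v v) • pauliOp v := by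
  ext x y
  rw [conjTranspose_apply, Matrix.smul_apply, pauliOp_apply, pauliOp_apply]
  have hiff : y = x + (fun i => v (Sum.inl i)) ↔ x = y + (fun i => v (Sum.inl i)) := by
    constructor <;> (rintro rfl; rw [add_assoc, zmodTwo_fun_add_self, add_zero])
  by_cases h : x = y + (fun i => v (Sum.inl i))
  · rw [if_pos h, if_pos (hiff.2 h)]
    change star (bitSign _) = bitSign _ * bitSign _
    rw [star_bitSign, ← bitSign_add]
    conv_lhs => rw [h]
    rw [dotProduct_add, add_comm]
    rfl
  · rw [if_neg h, if_neg (fun h' => h (hiff.1 h'))]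
    simp

theorem pauliOp_mul_conjTranspose {n : ℕ} (v : Fin n ⊕ Fin n → ZMod 2) :
    pauliOp v * (pauliOp v)ᴴ = 1 := by
  rw [pauliOp_conjTranspose, mul_smul_comm, pauliOp_mul_self, smul_smul, bitSign_mul_self,
    one_smul]

theorem pauliOp_conjTranspose_mul {n : ℕ} (v : Fin n ⊕ Fin n → ZMod 2) :
    (pauliOp v)ᴴ * pauliOp v = 1 :=
  mul_eq_one_comm.1 (pauliOp_mul_conjTranspose v)

theorem pauliOp_ne_zero {n : ℕ} (v : Fin n ⊕ Fin n → ZMod 2) : pauliOp v ≠ 0 := by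
  intro h
  have := pauliOp_mul_conjTranspose v
  rw [h, zero_mul] at this
  exact zero_ne_one this

/-- Two Pauli operators that are proportional on the basis states supported on the first `k`
qubits agree except for a `Z`-part on the remaining qubits. -/
theorem eq_of_pauliOp_eq_mul {n k : ℕ} {v w : Fin n ⊕ Fin n → ZMod 2} {a : ℂ}
    (h : ∀ x y : Bits n, (∀ j : Fin n, k ≤ (j : ℕ) → y j = 0) →
      pauliOp v x y = a * pauliOp w x y) :
    (∀ i, v (Sum.inl i) = w (Sum.inl i)) ∧
      ∀ i : Fin n, (i : ℕ) < k → v (Sum.inr i) = w (Sum.inr i) := by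
  -- Column 0 of a Pauli operator has one nonzero entry, a 1 in the row given by the X-part. It
  -- therefore determines the X-part and forces a = 1.
  have h0 := h (fun i => v (Sum.inl i)) 0 (fun _ _ => rfl)
  rw [pauliOp_apply, pauliOp_apply, if_pos (by simp)] at h0
  have hx : (fun i => v (Sum.inl i)) = fun i => w (Sum.inl i) := by
    by_contra hne
    rw [if_neg (by simpa using hne)] at h0
    simp at h0
  rw [if_pos (by simpa using hx)] at h0
  have ha : a = 1 := by simpa using h0.symm
  refine ⟨fun i => congrFun hx i, fun i hi => ?_⟩
  -- For i < k the basis vector at i is an admissible column, and the sign in it is the i-th bit of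
  -- the Z-part.
  have h1 := h (Pi.single i 1 + fun i => v (Sum.inl i)) (Pi.single i 1) (fun j hj => by
    rw [Pi.single_eq_of_ne]
    rintro rfl
    omega)
  rw [pauliOp_apply, pauliOp_apply, if_pos rfl, if_pos (by rw [hx]), ha, one_mul,
    dotProduct_single_one, dotProduct_single_one] at h1
  exact bitSign_injective h1

theorem pauliOp_smul_injective {n : ℕ} {v w : Fin n ⊕ Fin n → ZMod 2} {a : ℂ}
    (h : pauliOp v = a • pauliOp w) : v = w := by
  obtain ⟨hx, hz⟩ := eq_of_pauliOp_eq_mul (k := n) (v := v) (w := w) (a := a)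
    (fun x y _ => by rw [h]; rfl)
  ext (i | i)
  · exact hx i
  · exact hz i i.2

theorem exists_pauliForm_ne {n : ℕ} {v : Fin n ⊕ Fin n → ZMod 2} (hv : v ≠ 0) :
    ∃ w, pauliForm v w + pauliForm w v = 1 := by
  obtain ⟨i, hi⟩ := Function.ne_iff.1 hv
  have h2 : ∀ a : ZMod 2, a ≠ 0 → a = 1 := by decide
  have hi := h2 _ hi
  rcases i with i | i
  · refine ⟨Pi.single (Sum.inr i) 1, ?_⟩
    simp [pauliForm, dotProduct, Pi.single_apply, hi]
  · refine ⟨Pi.single (Sum.inl i) 1, ?_⟩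
    simp [pauliForm, dotProduct, Pi.single_apply, hi]

/-- Some Pauli operator anticommutes with P_v, so P_v is conjugate to -P_v. -/
theorem trace_pauliOp {n : ℕ} {v : Fin n ⊕ Fin n → ZMod 2} (hv : v ≠ 0) :
    (pauliOp v).trace = 0 := by
  obtain ⟨w, hw⟩ := exists_pauliForm_ne hv
  have h := pauliOp_commutation v w
  rw [hw, bitSign_one] at h
  have h1 : (pauliOp v * pauliOp w * (pauliOp w)ᴴ).trace = (pauliOp v).trace := by
    rw [Matrix.mul_assoc, pauliOp_mul_conjTranspose, Matrix.mul_one]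
  rw [h, smul_mul_assoc, trace_smul, Matrix.trace_mul_comm, ← Matrix.mul_assoc,
    pauliOp_conjTranspose_mul, Matrix.one_mul] at h1
  simp only [smul_eq_mul, neg_mul, one_mul] at h1
  linear_combination -h1 / 2

/-- Schur's lemma for the Pauli group. -/
theorem eq_smul_one_of_commute_pauliOp {n : ℕ} {M : Matrix (Bits n) (Bits n) ℂ}
    (hM : ∀ v, M * pauliOp v = pauliOp v * M) : M = M 0 0 • 1 := by
  have hZ : ∀ s : Bits n, M * pauliZ s = pauliZ s * M := fun s => by
    have h := hM (Sum.elim 0 s)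
    have e : pauliOp (Sum.elim (0 : Bits n) s) = pauliZ s := by
      ext x y
      rw [pauliOp_apply, pauliZ, diagonal_apply]
      have : (fun i : Fin n => (Sum.elim (0 : Bits n) s) (Sum.inl i)) = 0 := rfl
      rw [this, add_zero]
      split_ifs with hxy
      · rw [hxy]; rfl
      · rfl
    rwa [e] at h
  have hX : ∀ r : Bits n, M * pauliX r = pauliX r * M := fun r => by
    have h := hM (Sum.elim r 0)
    have e : pauliOp (Sum.elim r (0 : Bits n)) = pauliX r := by
      ext x y
      rw [pauliOp_apply]
      simp [pauliX]
    rwa [e] at h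
  ext x y
  rw [Matrix.smul_apply, one_apply, smul_eq_mul]
  split_ifs with hxy
  · subst hxy
    -- Entry (x, 0) of M X^x = X^x M compares the diagonal entries at x and at 0.
    have h := congrFun (congrFun (hX x) x) 0
    rw [Matrix.mul_apply, Matrix.mul_apply, Finset.sum_eq_single x, Finset.sum_eq_single 0] at h
    · simpa [pauliX] using h
    · intro z _ hz
      have : x ≠ z + x := fun h => hz (by simpa using h.symm)
      simp [pauliX, this]
    · simp
    · intro z _ hz
      simp [pauliX, hz]
    · simp
  · obtain ⟨i, hi⟩ := Function.ne_iff.1 hxy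
    have h := congrFun (congrFun (hZ (Pi.single i 1)) x) y
    rw [pauliZ, mul_diagonal, diagonal_mul, single_one_dotProduct, single_one_dotProduct] at h
    change M x y * bitSign (y i) = bitSign (x i) * M x y at h
    rw [mul_zero]
    by_contra hne
    rw [mul_comm] at h
    exact hi (bitSign_injective (mul_right_cancel₀ hne h)).symm

/-! ### Phases that turn a symplectic map into an automorphism of the Pauli group -/

/-- The matrix of `pauliForm`. -/
def pauliFormMatrix (n : ℕ) : Matrix (Fin n ⊕ Fin n) (Fin n ⊕ Fin n) (ZMod 2) :=
  fromBlocks 0 0 1 0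

theorem pauliForm_eq_dotProduct {n : ℕ} (v w : Fin n ⊕ Fin n → ZMod 2) :
    pauliForm v w = v ⬝ᵥ pauliFormMatrix n *ᵥ w := by
  rw [pauliFormMatrix, fromBlocks_mulVec]
  simp [pauliForm, dotProduct]

/-- The change of `pauliForm` under a linear map, as a matrix. -/
def pauliFormShift {n : ℕ} (A : Matrix (Fin n ⊕ Fin n) (Fin n ⊕ Fin n) (ZMod 2)) :
    Matrix (Fin n ⊕ Fin n) (Fin n ⊕ Fin n) (ZMod 2) :=
  Aᵀ * pauliFormMatrix n * A + pauliFormMatrix n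

theorem dotProduct_pauliFormShift {n : ℕ} (A : Matrix (Fin n ⊕ Fin n) (Fin n ⊕ Fin n) (ZMod 2))
    (v w : Fin n ⊕ Fin n → ZMod 2) :
    v ⬝ᵥ pauliFormShift A *ᵥ w = pauliForm (A *ᵥ v) (A *ᵥ w) + pauliForm v w := by
  rw [pauliForm_eq_dotProduct, pauliForm_eq_dotProduct, pauliFormShift, add_mulVec,
    dotProduct_add, ← mulVec_mulVec, ← mulVec_mulVec, dotProduct_mulVec v, vecMul_transpose]

theorem pauliFormMatrix_add_transpose (n : ℕ) :
    pauliFormMatrix n + (pauliFormMatrix n)ᵀ = J (Fin n) (ZMod 2) := by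
  have h : (-1 : Matrix (Fin n) (Fin n) (ZMod 2)) = 1 := by
    ext i j
    exact ZMod.neg_eq_self_mod_two _
  rw [pauliFormMatrix, fromBlocks_transpose, fromBlocks_add, J, h]
  simp

theorem pauliForm_add_swap {n : ℕ} (v w : Fin n ⊕ Fin n → ZMod 2) :
    pauliForm v w + pauliForm w v = v ⬝ᵥ J (Fin n) (ZMod 2) *ᵥ w := by
  rw [pauliForm_eq_dotProduct, pauliForm_eq_dotProduct, ← pauliFormMatrix_add_transpose,
    add_mulVec, dotProduct_add, mulVec_transpose, dotProduct_comm v (w ᵥ* _), ← dotProduct_mulVec]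

/-- With B the matrix of `pauliForm`, B + Bᵀ is the symplectic form, which A preserves. Hence AᵀBA
and B have the same antisymmetric defect, and in characteristic two their sum is symmetric. -/
theorem transpose_pauliFormShift {n : ℕ} (A : Sp n) :
    (pauliFormShift (A : Matrix (Fin n ⊕ Fin n) (Fin n ⊕ Fin n) (ZMod 2)))ᵀ = pauliFormShift A := by
  have h := SymplecticGroup.mem_iff'.1 A.2
  rw [← pauliFormMatrix_add_transpose, Matrix.mul_add, Matrix.add_mul] at h
  have two : ∀ M : Matrix (Fin n ⊕ Fin n) (Fin n ⊕ Fin n) (ZMod 2), M + M = 0 := fun M => by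
    ext i j
    exact CharTwo.add_self_eq_zero _
  rw [pauliFormShift, transpose_add, transpose_mul, transpose_mul, transpose_transpose,
    ← Matrix.mul_assoc]
  set X := (A : Matrix (Fin n ⊕ Fin n) (Fin n ⊕ Fin n) (ZMod 2))ᵀ * pauliFormMatrix n * A
  set Y := (A : Matrix (Fin n ⊕ Fin n) (Fin n ⊕ Fin n) (ZMod 2))ᵀ * (pauliFormMatrix n)ᵀ * A
  set B := pauliFormMatrix n
  calc Y + Bᵀ = (X + Y) + X + Bᵀ := by rw [add_comm X Y, add_assoc Y, two, add_zero]
    _ = X + B + (Bᵀ + Bᵀ) := by rw [h]; abel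
    _ = X + B := by rw [two, add_zero]

/-- The integral lift of the quadratic form of a binary matrix. -/
def liftedForm {ι : Type*} [Fintype ι] (G : Matrix ι ι (ZMod 2)) (v : ι → ZMod 2) : ℕ :=
  ∑ i, ∑ j, (v i).val * (G i j).val * (v j).val

/-- Bits add over ℤ as a + b - 2ab. Symmetry of G makes each mixed term occur twice: the carry
corrections become multiples of 4, and the cross term becomes 2·vᵀGw, which mod 4 depends only on
the parity of vᵀGw. -/
theorem liftedForm_add {ι : Type*} [Fintype ι] {G : Matrix ι ι (ZMod 2)} (hG : Gᵀ = G)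
    (v w : ι → ZMod 2) :
    liftedForm G (v + w) ≡ liftedForm G v + liftedForm G w + 2 * (v ⬝ᵥ G *ᵥ w).val [MOD 4] := by
  have hval : ∀ i, ((v + w) i).val + 2 * ((v i).val * (w i).val) = (v i).val + (w i).val := by
    have : ∀ a b : ZMod 2, (a + b).val + 2 * (a.val * b.val) = a.val + b.val := by decide
    exact fun i => this _ _
  have hmid : 2 * (v ⬝ᵥ G *ᵥ w).val ≡ 2 * ∑ i, ∑ j, (v i).val * (G i j).val * (w j).val [MOD 4] := by
    refine Nat.ModEq.mul_left' (n := 2) 2 ?_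
    rw [← ZMod.natCast_eq_natCast_iff]
    simp [dotProduct, mulVec, Finset.mul_sum, mul_assoc]
  refine Nat.ModEq.trans ?_ (Nat.ModEq.add_left _ hmid.symm)
  have hsymm : ∀ a b : ι → ℤ, ∑ i, ∑ j, a i * ((G i j).val : ℤ) * b j
      = ∑ i, ∑ j, b i * ((G i j).val : ℤ) * a j := fun a b => by
    rw [Finset.sum_comm]
    refine Finset.sum_congr rfl fun i _ => Finset.sum_congr rfl fun j _ => ?_
    rw [← congrFun (congrFun hG i) j, transpose_apply]
    ring
  rw [← Int.natCast_modEq_iff, Int.modEq_iff_dvd]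
  simp only [liftedForm]
  push_cast
  set a : ι → ℤ := fun i => ((v i).val : ℤ) with ha
  set b : ι → ℤ := fun i => ((w i).val : ℤ) with hb
  have hz : ∀ i, (((v i + w i).val : ℕ) : ℤ) = a i + b i - 2 * (a i * b i) := fun i => by
    have := congrArg (Nat.cast (R := ℤ)) (hval i)
    push_cast [Pi.add_apply] at this
    simp only [ha, hb]
    linarith
  set q : (ι → ℤ) → (ι → ℤ) → ℤ := fun x y => ∑ i, ∑ j, x i * ((G i j).val : ℤ) * y j with hq
  have hqs : ∀ x y, q x y = q y x := hsymm
  have e : ∑ i, ∑ j, (((v i + w i).val : ℕ) : ℤ) * ((G i j).val : ℤ) * (((v j + w j).val : ℕ) : ℤ)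
      = q a a + q b b + q a b + q b a - 2 * q (a + b) (a * b) - 2 * q (a * b) (a + b)
        + 4 * q (a * b) (a * b) := by
    simp only [hq, hz, Finset.mul_sum, ← Finset.sum_add_distrib, ← Finset.sum_sub_distrib,
      Pi.add_apply, Pi.mul_apply]
    refine Finset.sum_congr rfl fun i _ => Finset.sum_congr rfl fun j _ => ?_
    ring
  simp only [Pi.add_apply]
  rw [e, hqs b a, hqs (a * b) (a + b)]
  refine ⟨q (a + b) (a * b) - q (a * b) (a * b), ?_⟩
  simp only [hq, ha, hb]
  ring

/-- The phases that make `v ↦ pauliPhase A v • pauliOp (A v)` multiply like `pauliOp`. -/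
noncomputable def pauliPhase {n : ℕ} (A : Matrix (Fin n ⊕ Fin n) (Fin n ⊕ Fin n) (ZMod 2))
    (v : Fin n ⊕ Fin n → ZMod 2) : ℂ :=
  Complex.I ^ liftedForm (pauliFormShift A) v

theorem I_pow_congr {a b : ℕ} (h : a ≡ b [MOD 4]) : Complex.I ^ a = Complex.I ^ b := by
  rw [← Nat.div_add_mod a 4, ← Nat.div_add_mod b 4, pow_add, pow_add, pow_mul, pow_mul,
    Complex.I_pow_four, one_pow, one_pow, h]

theorem pauliPhase_ne_zero {n : ℕ} (A : Matrix (Fin n ⊕ Fin n) (Fin n ⊕ Fin n) (ZMod 2))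
    (v : Fin n ⊕ Fin n → ZMod 2) : pauliPhase A v ≠ 0 :=
  pow_ne_zero _ Complex.I_ne_zero

theorem pauliPhase_zero {n : ℕ} (A : Matrix (Fin n ⊕ Fin n) (Fin n ⊕ Fin n) (ZMod 2)) :
    pauliPhase A 0 = 1 := by
  simp [pauliPhase, liftedForm]

theorem star_pauliPhase_mul {n : ℕ} (A : Matrix (Fin n ⊕ Fin n) (Fin n ⊕ Fin n) (ZMod 2))
    (v : Fin n ⊕ Fin n → ZMod 2) : star (pauliPhase A v) * pauliPhase A v = 1 := by
  rw [pauliPhase, star_pow, ← mul_pow]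
  simp

theorem pauliPhase_add {n : ℕ} (A : Sp n) (v w : Fin n ⊕ Fin n → ZMod 2) :
    pauliPhase A.1 (v + w) = pauliPhase A.1 v * pauliPhase A.1 w *
      (bitSign (pauliForm (A.1 *ᵥ v) (A.1 *ᵥ w)) * bitSign (pauliForm v w)) := by
  rw [pauliPhase, I_pow_congr (liftedForm_add (transpose_pauliFormShift A) v w), pow_add, pow_add,
    dotProduct_pauliFormShift, pow_mul Complex.I 2, Complex.I_sq, ← bitSign_add]
  rfl

/-- The image of a Pauli operator under the automorphism of the Pauli group attached to `A`. -/
noncomputable def pauliImage {n : ℕ} (A : Matrix (Fin n ⊕ Fin n) (Fin n ⊕ Fin n) (ZMod 2))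
    (v : Fin n ⊕ Fin n → ZMod 2) : Matrix (Bits n) (Bits n) ℂ :=
  pauliPhase A v • pauliOp (A *ᵥ v)

/-- The failure of the phases to be multiplicative is exactly the change of `pauliForm` under A, so
the sign rule of the original operators is restored. -/
theorem pauliImage_mul {n : ℕ} (A : Sp n) (v w : Fin n ⊕ Fin n → ZMod 2) :
    pauliImage A.1 v * pauliImage A.1 w = bitSign (pauliForm v w) • pauliImage A.1 (v + w) := by
  rw [pauliImage, pauliImage, pauliImage, smul_mul_smul_comm, pauliOp_mul_eq, smul_smul, smul_smul,
    pauliPhase_add, mulVec_add]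
  congr 1
  have := bitSign_mul_self (pauliForm v w)
  linear_combination (-pauliPhase A.1 v * pauliPhase A.1 w *
    bitSign (pauliForm (A.1 *ᵥ v) (A.1 *ᵥ w))) * this

theorem pauliImage_conjTranspose_mul {n : ℕ}
    (A : Matrix (Fin n ⊕ Fin n) (Fin n ⊕ Fin n) (ZMod 2)) (v : Fin n ⊕ Fin n → ZMod 2) :
    (pauliImage A v)ᴴ * pauliImage A v = 1 := by
  rw [pauliImage, conjTranspose_smul, smul_mul_smul_comm, pauliOp_conjTranspose_mul,
    star_pauliPhase_mul, one_smul]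

/-! ### Unitaries realizing symplectic matrices -/

/-- Averaging a matrix into an intertwiner of `pauliOp` and `pauliImage A`. -/
noncomputable def pauliTwirl {n : ℕ} (A : Matrix (Fin n ⊕ Fin n) (Fin n ⊕ Fin n) (ZMod 2))
    (M : Matrix (Bits n) (Bits n) ℂ) : Matrix (Bits n) (Bits n) ℂ :=
  ∑ v, pauliImage A v * M * (pauliOp v)ᴴ

/-- Translating the summation index by w produces the same sign from both outer factors, and the two
signs cancel. -/
theorem pauliTwirl_mul_pauliOp {n : ℕ} (A : Sp n) (M : Matrix (Bits n) (Bits n) ℂ)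
    (w : Fin n ⊕ Fin n → ZMod 2) :
    pauliTwirl A.1 M * pauliOp w = pauliImage A.1 w * pauliTwirl A.1 M := by
  rw [pauliTwirl, Finset.sum_mul, Finset.mul_sum, ← Equiv.sum_comp (Equiv.addLeft w)]
  refine Finset.sum_congr rfl fun v _ => ?_
  have h1 : pauliImage A.1 (w + v) =
      bitSign (pauliForm w v) • (pauliImage A.1 w * pauliImage A.1 v) := by
    rw [pauliImage_mul, smul_smul, bitSign_mul_self, one_smul]
  rw [Equiv.coe_addLeft, h1, pauliOp_add, conjTranspose_smul, star_bitSign, conjTranspose_mul]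
  simp only [smul_mul_assoc, mul_smul_comm, smul_smul, bitSign_mul_self, one_smul,
    Matrix.mul_assoc, pauliOp_conjTranspose_mul, Matrix.mul_one]

/-- Twirl the matrix units in row 0 and sum their (0, c) entries over c. The v-th term acquires the
factor tr(P_v) conjugated, so only v = 0 survives, and it contributes 2^n. -/
theorem exists_pauliTwirl_ne_zero {n : ℕ}
    (A : Matrix (Fin n ⊕ Fin n) (Fin n ⊕ Fin n) (ZMod 2)) :
    ∃ M, pauliTwirl A M ≠ 0 := by
  by_contra! h
  have h1 : ∑ c, pauliTwirl A (Matrix.single 0 c 1) 0 c = 0 := by simp [h]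
  simp only [pauliTwirl, Matrix.sum_apply] at h1
  rw [Finset.sum_comm, Finset.sum_eq_single 0] at h1
  · have h2 : pauliImage A 0 = 1 := by
      rw [pauliImage, pauliPhase_zero, mulVec_zero, pauliOp_zero, one_smul]
    simp [h2, pauliOp_zero] at h1
  · intro v _ hv
    have h3 : ∀ c : Bits n, (pauliImage A v * (Matrix.single 0 c 1 : Matrix (Bits n) (Bits n) ℂ)
        * (pauliOp v)ᴴ : Matrix (Bits n) (Bits n) ℂ) 0 c
        = pauliImage A v 0 0 * star (pauliOp v c c) := fun c => by
      rw [Matrix.mul_apply, Finset.sum_eq_single c]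
      · simp
      · intro b _ hb
        rw [Matrix.mul_single_apply_of_ne _ _ _ _ _ hb, zero_mul]
      · simp
    simp only [h3]
    rw [← Finset.mul_sum, ← star_sum]
    have := trace_pauliOp hv
    rw [Matrix.trace] at this
    simp only [diag_apply] at this
    rw [this, star_zero, mul_zero]
  · simp

open scoped ComplexOrder in
/-- Every symplectic matrix is realized by a unitary, with prescribed phases. -/
theorem exists_unitary_conj_pauliOp {n : ℕ} (A : Sp n) :
    ∃ U : QUnitary n, ∀ v, U.1 * pauliOp v * U.1ᴴ = pauliImage A.1 v := by
  obtain ⟨M, hM⟩ := exists_pauliTwirl_ne_zero A.1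
  set T := pauliTwirl A.1 M with hT
  have hcomm := pauliTwirl_mul_pauliOp A M
  rw [← hT] at hcomm
  -- T intertwines two families of unitaries, so TᴴT commutes with every Pauli operator and Schur's
  -- lemma applies.
  have hscal : Tᴴ * T = (Tᴴ * T) 0 0 • 1 := by
    refine eq_smul_one_of_commute_pauliOp fun v => ?_
    have h1 : T = pauliImage A.1 v * T * (pauliOp v)ᴴ := by
      rw [← hcomm, Matrix.mul_assoc, pauliOp_mul_conjTranspose, Matrix.mul_one]
    have h2 : Tᴴ = pauliOp v * Tᴴ * (pauliImage A.1 v)ᴴ := by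
      conv_lhs => rw [h1]
      rw [conjTranspose_mul, conjTranspose_mul, conjTranspose_conjTranspose, Matrix.mul_assoc]
    calc Tᴴ * T * pauliOp v = Tᴴ * (pauliImage A.1 v * T) := by rw [Matrix.mul_assoc, hcomm]
      _ = pauliOp v * Tᴴ * ((pauliImage A.1 v)ᴴ * pauliImage A.1 v) * T := by
        conv_lhs => rw [h2]
        simp only [Matrix.mul_assoc]
      _ = _ := by rw [pauliImage_conjTranspose_mul, Matrix.mul_one, Matrix.mul_assoc]
  -- The scalar is the squared norm of column 0 of T, hence real and nonnegative; dividing T by its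
  -- square root gives a unitary.
  set r : ℝ := ∑ x, Complex.normSq (T x 0) with hr
  have hr0 : (Tᴴ * T) 0 0 = (r : ℂ) := by
    rw [Matrix.mul_apply, hr, Complex.ofReal_sum]
    refine Finset.sum_congr rfl fun x _ => ?_
    rw [conjTranspose_apply, Complex.normSq_eq_conj_mul_self]
    rfl
  rw [hr0] at hscal
  have hrnn : 0 ≤ r := Finset.sum_nonneg fun x _ => Complex.normSq_nonneg _
  have hrne : r ≠ 0 := by
    intro h
    rw [h, Complex.ofReal_zero, zero_smul, conjTranspose_mul_self_eq_zero] at hscal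
    exact hM hscal
  set s : ℂ := (((Real.sqrt r)⁻¹ : ℝ) : ℂ) with hs
  have hss : star s * s * r = 1 := by
    have : star s = s := Complex.conj_ofReal _
    rw [this, hs, ← Complex.ofReal_mul, ← Complex.ofReal_mul, ← mul_inv, Real.mul_self_sqrt hrnn,
      inv_mul_cancel₀ hrne, Complex.ofReal_one]
  have hU : (s • T)ᴴ * (s • T) = 1 := by
    rw [conjTranspose_smul, smul_mul_smul_comm, hscal, smul_smul, hss, one_smul]
  refine ⟨⟨s • T, mem_unitaryGroup_iff'.2 hU⟩, fun v => ?_⟩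
  change s • T * pauliOp v * (s • T)ᴴ = _
  rw [smul_mul_assoc, hcomm, ← mul_smul_comm, Matrix.mul_assoc, mul_eq_one_comm.1 hU,
    Matrix.mul_one]

/-! ### Clifford operators and their symplectic matrices -/

theorem QUnitary.mul_conjTranspose {n : ℕ} (U : QUnitary n) : U.1 * U.1ᴴ = 1 :=
  mem_unitaryGroup_iff.1 U.2

theorem QUnitary.conjTranspose_mul {n : ℕ} (U : QUnitary n) : U.1ᴴ * U.1 = 1 :=
  mem_unitaryGroup_iff'.1 U.2

/-- Pauli operators as unitaries. -/
def pauliUnitary {n : ℕ} (v : Fin n ⊕ Fin n → ZMod 2) : QUnitary n :=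
  ⟨pauliOp v, mem_unitaryGroup_iff.2 (pauliOp_mul_conjTranspose v)⟩

theorem SympRepresents.mul {n : ℕ} {U V : Matrix (Bits n) (Bits n) ℂ} {A B : Sp n}
    (hU : SympRepresents U A) (hV : SympRepresents V B) : SympRepresents (U * V) (A * B) := by
  intro v
  obtain ⟨b, hb, hbv⟩ := hV v
  obtain ⟨a, ha, hav⟩ := hU (B.1 *ᵥ v)
  refine ⟨b * a, mul_ne_zero hb ha, ?_⟩
  calc U * V * pauliOp v * (U * V)ᴴ = U * (V * pauliOp v * Vᴴ) * Uᴴ := by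
        rw [conjTranspose_mul]; simp only [Matrix.mul_assoc]
    _ = _ := by
      rw [hbv, mul_smul_comm, smul_mul_assoc, hav, smul_smul, mulVec_mulVec]
      rfl

theorem SympRepresents.conjTranspose {n : ℕ} {U : QUnitary n} {A : Sp n}
    (hU : SympRepresents U.1 A) : SympRepresents U.1ᴴ A⁻¹ := by
  intro v
  obtain ⟨a, ha, hav⟩ := hU ((A⁻¹ : Sp n).1 *ᵥ v)
  have hA : A.1 *ᵥ ((A⁻¹ : Sp n).1 *ᵥ v) = v := by
    rw [mulVec_mulVec, ← Submonoid.coe_mul, mul_inv_cancel, Submonoid.coe_one, one_mulVec]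
  rw [hA] at hav
  refine ⟨a⁻¹, inv_ne_zero ha, ?_⟩
  rw [conjTranspose_conjTranspose, eq_inv_smul_iff₀ ha, ← smul_mul_assoc, ← mul_smul_comm, ← hav]
  simp only [← Matrix.mul_assoc]
  rw [U.conjTranspose_mul, Matrix.one_mul, Matrix.mul_assoc, U.conjTranspose_mul, Matrix.mul_one]

theorem SympRepresents.unique {n : ℕ} {U : Matrix (Bits n) (Bits n) ℂ} {A B : Sp n}
    (hA : SympRepresents U A) (hB : SympRepresents U B) : A = B := by
  refine Subtype.ext (Matrix.toLin'.injective (LinearMap.ext fun v => ?_))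
  obtain ⟨a, ha, hav⟩ := hA v
  obtain ⟨b, hb, hbv⟩ := hB v
  rw [toLin'_apply, toLin'_apply]
  refine pauliOp_smul_injective (a := a⁻¹ * b) ?_
  rw [mul_smul, eq_inv_smul_iff₀ ha]
  exact hav.symm.trans hbv

theorem exists_eq_I_pow {c : ℂ} (hc : c ^ 4 = 1) : ∃ q : ℕ, c = Complex.I ^ q := by
  have h : (c - 1) * (c + 1) * ((c - Complex.I) * (c + Complex.I)) = 0 := by
    linear_combination hc - (c ^ 2 - 1) * Complex.I_sq
  rcases mul_eq_zero.1 h with h | h <;> rcases mul_eq_zero.1 h with h | h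
  · exact ⟨0, by linear_combination h⟩
  · exact ⟨2, by rw [Complex.I_sq]; linear_combination h⟩
  · exact ⟨1, by linear_combination h⟩
  · exact ⟨3, by rw [pow_succ, Complex.I_sq]; linear_combination h⟩

/-- The phases in a symplectic representation of a unitary are powers of `i`. -/
theorem exists_I_pow_of_conj_pauliOp {n : ℕ} {U : QUnitary n} {v w : Fin n ⊕ Fin n → ZMod 2}
    {c : ℂ} (h : U.1 * pauliOp v * U.1ᴴ = c • pauliOp w) : ∃ q : ℕ, c = Complex.I ^ q := by
  apply exists_eq_I_pow
  -- Pauli operators square to ±1, so squaring both sides gives c² = ±1.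
  have h1 : (U.1 * pauliOp v * U.1ᴴ) * (U.1 * pauliOp v * U.1ᴴ) = bitSign (pauliForm v v) • 1 := by
    calc _ = U.1 * pauliOp v * (U.1ᴴ * U.1) * (pauliOp v * U.1ᴴ) := by
          simp only [Matrix.mul_assoc]
      _ = U.1 * (pauliOp v * pauliOp v) * U.1ᴴ := by
          rw [U.conjTranspose_mul, Matrix.mul_one]; simp only [Matrix.mul_assoc]
      _ = _ := by
          rw [pauliOp_mul_self, mul_smul_comm, smul_mul_assoc, Matrix.mul_one, U.mul_conjTranspose]
  rw [h, smul_mul_smul_comm, pauliOp_mul_self, smul_smul] at h1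
  have h2 := congrFun (congrFun h1 0) 0
  simp only [Matrix.smul_apply, one_apply_eq, smul_eq_mul, mul_one] at h2
  have h3 := bitSign_mul_self (pauliForm v v)
  have h4 := bitSign_mul_self (pauliForm w w)
  calc c ^ 4 = (c * c * bitSign (pauliForm w w)) * (c * c * bitSign (pauliForm w w)) := by
        linear_combination (-c ^ 4) * h4
    _ = 1 := by rw [h2, h3]

theorem conj_mem_pauliGroup {n : ℕ} {U : QUnitary n} {A : Sp n} (hU : SympRepresents U.1 A)
    {P : QUnitary n} (hP : P ∈ pauliGroup n) : U * P * U⁻¹ ∈ pauliGroup n := by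
  obtain ⟨q, v, hv⟩ := hP
  obtain ⟨c, _, hc⟩ := hU v
  obtain ⟨p, rfl⟩ := exists_I_pow_of_conj_pauliOp hc
  refine ⟨q + p, A.1 *ᵥ v, ?_⟩
  change U.1 * P.1 * U.1ᴴ = _
  rw [hv, mul_smul_comm, smul_mul_assoc, hc, smul_smul, pow_add]

/-- A unitary represented by a symplectic matrix is a Clifford operator. -/
theorem SympRepresents.mem_cliffordGroup {n : ℕ} {U : QUnitary n} {A : Sp n}
    (hU : SympRepresents U.1 A) : U ∈ cliffordGroup n := by
  refine Subgroup.mem_normalizer_iff.2 fun P => ⟨conj_mem_pauliGroup hU, fun h => ?_⟩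
  have h2 := conj_mem_pauliGroup (U := U⁻¹) (A := A⁻¹) hU.conjTranspose h
  simpa [mul_assoc] using h2

/-- Every Clifford operator is represented by a symplectic matrix. -/
theorem exists_sympRepresents {n : ℕ} {U : QUnitary n} (hU : U ∈ cliffordGroup n) :
    ∃ A : Sp n, SympRepresents U.1 A := by
  have h : ∀ v : Fin n ⊕ Fin n → ZMod 2, ∃ (q : ℕ) (w : Fin n ⊕ Fin n → ZMod 2),
      U.1 * pauliOp v * U.1ᴴ = Complex.I ^ q • pauliOp w := fun v =>
    (Subgroup.mem_normalizer_iff.1 hU (pauliUnitary v)).1 ⟨0, v, by simp [pauliUnitary]⟩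
  choose q f hf using h
  have hI : ∀ m : ℕ, Complex.I ^ m ≠ 0 := fun m => pow_ne_zero _ Complex.I_ne_zero
  have hmul : ∀ v w, U.1 * (pauliOp v * pauliOp w) * U.1ᴴ
      = (Complex.I ^ q v * Complex.I ^ q w) • (pauliOp (f v) * pauliOp (f w)) := fun v w => by
    rw [← smul_mul_smul_comm, ← hf, ← hf]
    calc _ = U.1 * pauliOp v * 1 * (pauliOp w * U.1ᴴ) := by
          rw [Matrix.mul_one]; simp only [Matrix.mul_assoc]
      _ = _ := by rw [← U.conjTranspose_mul]; simp only [Matrix.mul_assoc]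
  have hadd : ∀ v w, f (v + w) = f v + f w := fun v w => by
    have h1 := hmul v w
    rw [pauliOp_mul_eq, pauliOp_mul_eq, mul_smul_comm, smul_mul_assoc, hf, smul_smul,
      smul_smul] at h1
    have hne : bitSign (pauliForm v w) * Complex.I ^ q (v + w) ≠ 0 :=
      mul_ne_zero (bitSign_ne_zero _) (hI _)
    rw [← eq_inv_smul_iff₀ hne, smul_smul] at h1
    exact pauliOp_smul_injective h1
  -- Conjugation preserves commutation signs, and these are the symplectic form.
  have hform : ∀ v w, pauliForm (f v) (f w) + pauliForm (f w) (f v)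
      = pauliForm v w + pauliForm w v := fun v w => by
    have h1 := hmul v w
    rw [pauliOp_commutation, mul_smul_comm, smul_mul_assoc, hmul, pauliOp_commutation (f v),
      smul_comm, mul_comm (Complex.I ^ q w)] at h1
    have h2 := smul_right_injective _ (mul_ne_zero (hI (q v)) (hI (q w))) h1
    refine bitSign_injective (smul_left_injective ℂ (m := pauliOp (f w) * pauliOp (f v)) ?_ h2.symm)
    rw [pauliOp_mul_eq]
    exact smul_ne_zero (bitSign_ne_zero _) (pauliOp_ne_zero _)
  set φ : (Fin n ⊕ Fin n → ZMod 2) →ₗ[ZMod 2] (Fin n ⊕ Fin n → ZMod 2) :=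
    (AddMonoidHom.mk' f hadd).toZModLinearMap 2 with hφ
  have hfA : ∀ v, LinearMap.toMatrix' φ *ᵥ v = f v := fun v => LinearMap.toMatrix'_mulVec φ v
  refine ⟨⟨LinearMap.toMatrix' φ, SymplecticGroup.mem_iff'.2 ?_⟩, fun v => ⟨_, hI (q v), ?_⟩⟩
  · ext i j
    have h1 := hform (Pi.single i 1) (Pi.single j 1)
    rw [pauliForm_add_swap, pauliForm_add_swap, ← hfA, ← hfA, dotProduct_mulVec,
      ← vecMul_transpose, vecMul_vecMul, ← dotProduct_mulVec, single_one_dotProduct,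
      single_one_dotProduct, mulVec_mulVec, mulVec_single_one, mulVec_single_one] at h1
    exact h1
  · rw [hf]
    exact congrArg (fun w => Complex.I ^ q v • pauliOp w) (hfA v).symm

/-! ### Operators and states on the first k qubits -/

/-- The basis states `|b⟩ ⊗ |0⟩^{⊗ (n - k)}`. -/
def SupportedOnFirst {n : ℕ} (k : ℕ) (x : Bits n) : Prop := ∀ j : Fin n, k ≤ (j : ℕ) → x j = 0

/-- Replace the first `k` bits of `x` by `b`. -/
def joinBits {n k : ℕ} (b : Bits k) (x : Bits n) : Bits n := fun j =>
  if h : (j : ℕ) < k then b ⟨j, h⟩ else x j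

theorem firstBits_joinBits {n k : ℕ} (hk : k ≤ n) (b : Bits k) (x : Bits n) :
    firstBits hk (joinBits b x) = b := by
  ext i
  simp [firstBits, joinBits]

theorem joinBits_apply_of_le {n k : ℕ} (b : Bits k) (x : Bits n) {j : Fin n} (hj : k ≤ (j : ℕ)) :
    joinBits b x j = x j := by
  simp [joinBits, not_lt.2 hj]

theorem joinBits_firstBits {n k : ℕ} (hk : k ≤ n) {x y : Bits n}
    (h : ∀ j : Fin n, k ≤ (j : ℕ) → x j = y j) : joinBits (firstBits hk y) x = y := by
  ext j
  by_cases hj : (j : ℕ) < k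
  · simp [joinBits, hj, firstBits]
  · simp [joinBits, hj, h j (not_lt.1 hj)]

theorem sum_ite_agree {n k : ℕ} (hk : k ≤ n) (x : Bits n) (f : Bits n → ℂ) :
    ∑ y, (if ∀ j : Fin n, k ≤ (j : ℕ) → x j = y j then f y else 0)
      = ∑ b : Bits k, f (joinBits b x) := by
  rw [← Finset.sum_filter]
  refine Finset.sum_nbij' (firstBits hk) (fun b => joinBits b x) ?_ ?_ ?_ ?_ ?_
  · simp
  · intro b _
    simp only [Finset.mem_filter, Finset.mem_univ, true_and]
    exact fun j hj => (joinBits_apply_of_le b x hj).symm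
  · intro y hy
    simp only [Finset.mem_filter, Finset.mem_univ, true_and] at hy
    exact joinBits_firstBits hk hy
  · intro b _
    exact firstBits_joinBits hk b x
  · intro y hy
    simp only [Finset.mem_filter, Finset.mem_univ, true_and] at hy
    simp only [joinBits_firstBits hk hy]

theorem tensorOne_mul {n k : ℕ} (hk : k ≤ n) (V W : Matrix (Bits k) (Bits k) ℂ) :
    tensorOne hk V * tensorOne hk W = tensorOne hk (V * W) := by
  ext x z
  simp only [Matrix.mul_apply, tensorOne, of_apply, ite_mul, zero_mul]
  rw [sum_ite_agree hk x (fun y => V (firstBits hk x) (firstBits hk y) *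
    if ∀ j : Fin n, k ≤ (j : ℕ) → y j = z j then W (firstBits hk y) (firstBits hk z) else 0)]
  have h : ∀ b : Bits k, (∀ j : Fin n, k ≤ (j : ℕ) → joinBits b x j = z j) ↔
      ∀ j : Fin n, k ≤ (j : ℕ) → x j = z j := fun b =>
    forall₂_congr fun j hj => by rw [joinBits_apply_of_le b x hj]
  simp only [h, firstBits_joinBits]
  split_ifs <;> simp

theorem tensorOne_one {n k : ℕ} (hk : k ≤ n) : tensorOne hk (1 : Matrix (Bits k) (Bits k) ℂ) = 1 := by
  ext x y
  simp only [tensorOne, of_apply, one_apply]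
  by_cases h : x = y
  · simp [h]
  · rw [if_neg h]
    split_ifs with h1 h2
    · exact absurd (by rw [← joinBits_firstBits hk h1, ← h2, joinBits_firstBits hk fun _ _ => rfl]) h
    · rfl
    · rfl

theorem tensorOne_conjTranspose {n k : ℕ} (hk : k ≤ n) (V : Matrix (Bits k) (Bits k) ℂ) :
    (tensorOne hk V)ᴴ = tensorOne hk Vᴴ := by
  ext x y
  have h : (∀ j : Fin n, k ≤ (j : ℕ) → y j = x j) ↔ ∀ j : Fin n, k ≤ (j : ℕ) → x j = y j :=
    forall₂_congr fun j _ => eq_comm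
  simp only [conjTranspose_apply, tensorOne, of_apply, h]
  split_ifs <;> simp

/-- `V ⊗ 1` as a unitary. -/
def tensorOneUnitary {n k : ℕ} (hk : k ≤ n) (V : QUnitary k) : QUnitary n :=
  ⟨tensorOne hk V.1, mem_unitaryGroup_iff.2 (by
    rw [star_eq_conjTranspose, tensorOne_conjTranspose, tensorOne_mul, V.mul_conjTranspose,
      tensorOne_one])⟩

theorem tensorOne_mulVec_tensorZero {n k : ℕ} (hk : k ≤ n) (V : Matrix (Bits k) (Bits k) ℂ)
    (ψ : Bits k → ℂ) : tensorOne hk V *ᵥ tensorZero hk ψ = tensorZero hk (V *ᵥ ψ) := by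
  ext x
  simp only [mulVec, dotProduct, tensorOne, of_apply, tensorZero, ite_mul, zero_mul]
  rw [sum_ite_agree hk x (fun y => V (firstBits hk x) (firstBits hk y) *
    if ∀ j : Fin n, k ≤ (j : ℕ) → y j = 0 then ψ (firstBits hk y) else 0)]
  have h : ∀ b : Bits k, (∀ j : Fin n, k ≤ (j : ℕ) → joinBits b x j = 0) ↔
      ∀ j : Fin n, k ≤ (j : ℕ) → x j = 0 := fun b =>
    forall₂_congr fun j hj => by rw [joinBits_apply_of_le b x hj]
  simp only [h, firstBits_joinBits]
  split_ifs <;> simp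

theorem tensorZero_of_supported {n k : ℕ} (hk : k ≤ n) (ψ : Bits k → ℂ) {x : Bits n}
    (hx : SupportedOnFirst k x) : tensorZero hk ψ x = ψ (firstBits hk x) :=
  if_pos hx

theorem tensorZero_of_not_supported {n k : ℕ} (hk : k ≤ n) (ψ : Bits k → ℂ) {x : Bits n}
    (hx : ¬ SupportedOnFirst k x) : tensorZero hk ψ x = 0 :=
  if_neg hx

theorem pauliOp_elim_apply {n : ℕ} (r s x y : Bits n) :
    pauliOp (Sum.elim r s) x y = if x = y + r then bitSign (s ⬝ᵥ y) else 0 :=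
  pauliOp_apply _ _ _

theorem tensorZero_single {n k : ℕ} (hk : k ≤ n) {z : Bits n} (hz : SupportedOnFirst k z) :
    tensorZero hk (Pi.single (firstBits hk z) 1) = Pi.single z 1 := by
  ext x
  by_cases hxz : x = z
  · subst hxz
    rw [tensorZero_of_supported hk _ hz]
    simp
  · rw [tensorZero, Pi.single_eq_of_ne hxz]
    split_ifs with h
    · refine Pi.single_eq_of_ne (fun h1 => hxz ?_) _
      rw [← joinBits_firstBits hk (fun j hj => (h j hj).trans (hz j hj).symm), ← h1,
        joinBits_firstBits hk fun _ _ => rfl]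
    · rfl

/-! ### Freedom matrices and scalar action on the states |ψ⟩ ⊗ |0⟩ -/

/-- `W` acts as the scalar `c` on the states `|ψ⟩ ⊗ |0⟩^{⊗ (n - k)}`. -/
def IsScalarOnFirst {n : ℕ} (k : ℕ) (W : Matrix (Bits n) (Bits n) ℂ) (c : ℂ) : Prop :=
  ∀ x z : Bits n, SupportedOnFirst k z → W x z = if x = z then c else 0

theorem isScalarOnFirst_iff {n k : ℕ} (hk : k ≤ n) {W : Matrix (Bits n) (Bits n) ℂ} {c : ℂ} :
    IsScalarOnFirst k W c ↔ ∀ ψ, W *ᵥ tensorZero hk ψ = c • tensorZero hk ψ := by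
  constructor
  · intro h ψ
    ext x
    rw [mulVec, dotProduct, Finset.sum_eq_single x]
    · by_cases hx : SupportedOnFirst k x
      · rw [h x x hx, if_pos rfl]
        rfl
      · rw [Pi.smul_apply, tensorZero_of_not_supported hk _ hx, mul_zero, smul_zero]
    · intro z _ hzx
      by_cases hz : SupportedOnFirst k z
      · rw [h x z hz, if_neg hzx.symm, zero_mul]
      · rw [tensorZero_of_not_supported hk _ hz, mul_zero]
    · simp
  · intro h x z hz
    have h1 := congrFun (h (Pi.single (firstBits hk z) 1)) x
    rw [tensorZero_single hk hz, mulVec_single_one] at h1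
    simpa [Pi.single_apply] using h1

theorem IsScalarOnFirst.mul_apply {n k : ℕ} {W : Matrix (Bits n) (Bits n) ℂ} {c : ℂ}
    (hW : IsScalarOnFirst k W c) (X : Matrix (Bits n) (Bits n) ℂ) {x y : Bits n}
    (hX : ∀ z, X z y ≠ 0 → SupportedOnFirst k z) : (W * X) x y = c * X x y := by
  rw [Matrix.mul_apply, Finset.sum_eq_single x]
  · by_cases h : X x y = 0
    · simp [h]
    · rw [hW x x (hX x h), if_pos rfl]
  · intro z _ hzx
    by_cases h : X z y = 0
    · simp [h]
    · rw [hW x z (hX z h), if_neg hzx.symm, zero_mul]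
  · simp

theorem IsScalarOnFirst.apply_mul {n k : ℕ} {W : Matrix (Bits n) (Bits n) ℂ} {c : ℂ}
    (hW : IsScalarOnFirst k W c) (X : Matrix (Bits n) (Bits n) ℂ) {x y : Bits n}
    (hy : SupportedOnFirst k y) : (X * W) x y = X x y * c := by
  rw [Matrix.mul_apply, Finset.sum_eq_single y]
  · rw [hW y y hy, if_pos rfl]
  · intro z _ hzy
    rw [hW z y hy, if_neg hzy, mul_zero]
  · simp

theorem supportedOnFirst_of_pauliOp_ne_zero {n k : ℕ} {v : Fin n ⊕ Fin n → ZMod 2}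
    (hv : SupportedOnFirst k fun i => v (Sum.inl i)) {z y : Bits n} (hy : SupportedOnFirst k y)
    (h : pauliOp v z y ≠ 0) : SupportedOnFirst k z := by
  rw [pauliOp_apply] at h
  by_cases hz : z = y + fun i => v (Sum.inl i)
  · intro j hj
    rw [hz, Pi.add_apply, hy j hj, zero_add]
    exact hv j hj
  · exact absurd (if_neg hz) h

/-- This replaces block entries by a condition on vectors: the admissible v are those whose P_v
preserves the states |ψ⟩ ⊗ |0⟩, and F may change them only by a Z-part acting trivially there. The
entries are recovered by testing on basis vectors. -/
theorem hasFreedomShape_iff {n k : ℕ} {F : Matrix (Fin n ⊕ Fin n) (Fin n ⊕ Fin n) (ZMod 2)} :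
    HasFreedomShape k F ↔ ∀ v : Fin n ⊕ Fin n → ZMod 2,
      (SupportedOnFirst k fun i => v (Sum.inl i)) →
      (∀ i, (F *ᵥ v) (Sum.inl i) = v (Sum.inl i)) ∧
        ∀ i : Fin n, (i : ℕ) < k → (F *ᵥ v) (Sum.inr i) = v (Sum.inr i) := by
  constructor
  · intro h v hv
    constructor
    · intro i
      rw [mulVec, dotProduct, Fintype.sum_sum_type, Finset.sum_eq_single i,
        Finset.sum_eq_zero fun j _ => by rw [h.xz, zero_mul], add_zero]
      · by_cases hi : (i : ℕ) < k
        · rw [h.xx i i hi, if_pos rfl, one_mul]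
        · rw [show v (Sum.inl i) = 0 from hv i (not_lt.1 hi), mul_zero]
      · intro j _ hji
        by_cases hj : (j : ℕ) < k
        · rw [h.xx i j hj, if_neg hji.symm, zero_mul]
        · rw [show v (Sum.inl j) = 0 from hv j (not_lt.1 hj), mul_zero]
      · simp
    · intro i hi
      rw [mulVec, dotProduct, Fintype.sum_sum_type, Finset.sum_eq_zero, zero_add,
        Finset.sum_eq_single i]
      · rw [h.zz i i hi, if_pos rfl, one_mul]
      · intro j _ hji
        rw [h.zz i j hi, if_neg hji.symm, zero_mul]
      · simp
      · intro j _
        by_cases hj : (j : ℕ) < k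
        · rw [h.zx i j hi hj, zero_mul]
        · rw [show v (Sum.inl j) = 0 from hv j (not_lt.1 hj), mul_zero]
  · intro h
    have hl : ∀ j : Fin n, (j : ℕ) < k → SupportedOnFirst k fun i =>
        (Pi.single (Sum.inl j) 1 : Fin n ⊕ Fin n → ZMod 2) (Sum.inl i) := fun j hj i hi => by
      refine Pi.single_eq_of_ne (fun e => ?_) _
      rw [Sum.inl.inj e] at hi
      omega
    have hr : ∀ j : Fin n, SupportedOnFirst k fun i =>
        (Pi.single (Sum.inr j) 1 : Fin n ⊕ Fin n → ZMod 2) (Sum.inl i) := fun j i _ =>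
      Pi.single_eq_of_ne (by simp) _
    refine ⟨fun i j hj => ?_, fun i j => ?_, fun i j hi hj => ?_, fun i j hi => ?_⟩
    · simpa [mulVec_single_one, Pi.single_apply] using (h _ (hl j hj)).1 i
    · simpa [mulVec_single_one, Pi.single_apply] using (h _ (hr j)).1 i
    · simpa [mulVec_single_one, Pi.single_apply] using (h _ (hl j hj)).2 i hi
    · simpa [mulVec_single_one, Pi.single_apply] using (h _ (hr j)).2 i hi

/-- A unitary acting as a scalar on the states `|ψ⟩ ⊗ |0⟩` is represented by a freedom matrix. -/
theorem IsScalarOnFirst.mem_freedomSet {n k : ℕ} {W : QUnitary n} {c : ℂ}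
    (hW : IsScalarOnFirst k W.1 c) {F : Sp n} (hF : SympRepresents W.1 F) :
    F ∈ freedomSet n k := by
  have hc : c ≠ 0 := by
    rintro rfl
    have h := hW.apply_mul W.1ᴴ (x := 0) (y := 0) fun _ _ => rfl
    rw [W.conjTranspose_mul] at h
    simp at h
  refine hasFreedomShape_iff.2 fun v hv => ?_
  obtain ⟨a, _, ha⟩ := hF v
  have h1 : W.1 * pauliOp v = a • (pauliOp (F.1 *ᵥ v) * W.1) := by
    rw [← smul_mul_assoc, ← ha, Matrix.mul_assoc, W.conjTranspose_mul, Matrix.mul_one]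
  -- On a supported column y, W contributes the factor c on either side, since P_v keeps the column
  -- supported.
  have h2 : ∀ x y : Bits n, (∀ j : Fin n, k ≤ (j : ℕ) → y j = 0) →
      pauliOp v x y = a * pauliOp (F.1 *ᵥ v) x y := fun x y hy => by
    have h3 := congrFun (congrFun h1 x) y
    rw [hW.mul_apply _ fun z => supportedOnFirst_of_pauliOp_ne_zero hv hy, Matrix.smul_apply,
      hW.apply_mul _ hy, smul_eq_mul] at h3
    exact mul_left_cancel₀ hc (by linear_combination h3)
  obtain ⟨h3, h4⟩ := eq_of_pauliOp_eq_mul h2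
  exact ⟨fun i => (h3 i).symm, fun i hi => (h4 i hi).symm⟩

/-- F alters the Z-part of v only on the last qubits, where the X-part of w vanishes. -/
theorem HasFreedomShape.pauliForm_eq {n k : ℕ}
    {F : Matrix (Fin n ⊕ Fin n) (Fin n ⊕ Fin n) (ZMod 2)} (hF : HasFreedomShape k F)
    {v w : Fin n ⊕ Fin n → ZMod 2} (hv : SupportedOnFirst k fun i => v (Sum.inl i))
    (hw : SupportedOnFirst k fun i => w (Sum.inl i)) :
    pauliForm (F *ᵥ v) (F *ᵥ w) = pauliForm v w := by
  have h1 := hasFreedomShape_iff.1 hF v hv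
  have h2 := hasFreedomShape_iff.1 hF w hw
  rw [pauliForm, pauliForm, dotProduct, dotProduct]
  refine Finset.sum_congr rfl fun i _ => ?_
  simp only [h2.1]
  by_cases hi : (i : ℕ) < k
  · rw [h1.2 i hi]
  · rw [show w (Sum.inl i) = 0 from hw i (not_lt.1 hi), mul_zero, mul_zero]

/-- Each basis vector in the support of v is itself admissible, so the entries of `pauliFormShift F`
that enter the lifted form are all zero. -/
theorem HasFreedomShape.pauliPhase_eq_one {n k : ℕ}
    {F : Matrix (Fin n ⊕ Fin n) (Fin n ⊕ Fin n) (ZMod 2)} (hF : HasFreedomShape k F)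
    {v : Fin n ⊕ Fin n → ZMod 2} (hv : SupportedOnFirst k fun i => v (Sum.inl i)) :
    pauliPhase F v = 1 := by
  have hs : ∀ i, v i ≠ 0 → SupportedOnFirst k fun l =>
      (Pi.single i 1 : Fin n ⊕ Fin n → ZMod 2) (Sum.inl l) := fun i hi l hl => by
    refine Pi.single_eq_of_ne (fun e => hi ?_) _
    rw [← e]
    exact hv l hl
  have h : liftedForm (pauliFormShift F) v = 0 := by
    refine Finset.sum_eq_zero fun i _ => Finset.sum_eq_zero fun j _ => ?_
    by_cases hi : v i = 0
    · simp [hi]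
    by_cases hj : v j = 0
    · simp [hj]
    have h1 := dotProduct_pauliFormShift F (Pi.single i 1) (Pi.single j 1)
    rw [hF.pauliForm_eq (hs i hi) (hs j hj), CharTwo.add_self_eq_zero, single_one_dotProduct,
      mulVec_single_one] at h1
    rw [show pauliFormShift F i j = 0 from h1]
    simp
  rw [pauliPhase, h, pow_zero]

theorem HasFreedomShape.pauliOp_mulVec_apply {n k : ℕ}
    {F : Matrix (Fin n ⊕ Fin n) (Fin n ⊕ Fin n) (ZMod 2)} (hF : HasFreedomShape k F)
    {v : Fin n ⊕ Fin n → ZMod 2} (hv : SupportedOnFirst k fun i => v (Sum.inl i))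
    (x : Bits n) {y : Bits n} (hy : SupportedOnFirst k y) :
    pauliOp (F *ᵥ v) x y = pauliOp v x y := by
  have h := hasFreedomShape_iff.1 hF v hv
  have hd : (fun i => (F *ᵥ v) (Sum.inr i)) ⬝ᵥ y = (fun i => v (Sum.inr i)) ⬝ᵥ y := by
    refine Finset.sum_congr rfl fun i _ => ?_
    by_cases hi : (i : ℕ) < k
    · simp only [h.2 i hi]
    · rw [hy i (not_lt.1 hi), mul_zero, mul_zero]
  rw [pauliOp_apply, pauliOp_apply, hd]
  simp only [h.1]

/-- Every freedom matrix represents a unitary acting as a phase on the states `|ψ⟩ ⊗ |0⟩`. -/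
theorem exists_isScalarOnFirst {n k : ℕ} {F : Sp n} (hF : F ∈ freedomSet n k) :
    ∃ (W : QUnitary n) (c : ℂ), ‖c‖ = 1 ∧ IsScalarOnFirst k W.1 c ∧ SympRepresents W.1 F := by
  obtain ⟨W, hW⟩ := exists_unitary_conj_pauliOp F
  have hrep : SympRepresents W.1 F := fun v => ⟨_, pauliPhase_ne_zero F.1 v, hW v⟩
  have hcomm : ∀ v : Fin n ⊕ Fin n → ZMod 2, (SupportedOnFirst k fun i => v (Sum.inl i)) →
      ∀ x y, SupportedOnFirst k y → (pauliOp v * W.1ᴴ) x y = (W.1ᴴ * pauliOp v) x y := by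
    intro v hv x y hy
    have h1 : pauliOp v * W.1ᴴ = W.1ᴴ * pauliOp (F.1 *ᵥ v) := by
      have h2 := hW v
      rw [pauliImage, HasFreedomShape.pauliPhase_eq_one hF hv, one_smul] at h2
      rw [← h2]
      simp only [← Matrix.mul_assoc]
      rw [W.conjTranspose_mul, Matrix.one_mul]
    rw [h1, Matrix.mul_apply, Matrix.mul_apply]
    refine Finset.sum_congr rfl fun z _ => ?_
    rw [HasFreedomShape.pauliOp_mulVec_apply hF hv z hy]
  have h0 : SupportedOnFirst k (0 : Bits n) := fun _ _ => rfl
  have hcol : ∀ x, x ≠ 0 → W.1ᴴ x 0 = 0 := by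
    intro x hx
    obtain ⟨i, hi⟩ := Function.ne_iff.1 hx
    -- Z on qubit i fixes |0⟩, hence fixes W†|0⟩, which leaves no amplitude at x when x i ≠ 0.
    have h := hcomm (Sum.elim 0 (Pi.single i 1)) h0 x 0 h0
    rw [Matrix.mul_apply, Matrix.mul_apply, Finset.sum_eq_single x, Finset.sum_eq_single 0] at h
    · rw [pauliOp_elim_apply, pauliOp_elim_apply, if_pos (by simp), if_pos (by simp),
        single_one_dotProduct, dotProduct_zero] at h
      have hne : bitSign (x i) ≠ bitSign 0 := fun e => hi (bitSign_injective e)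
      by_contra h2
      exact hne (mul_right_cancel₀ h2 (by rw [h, mul_comm]))
    · intro z _ hz
      rw [pauliOp_elim_apply, if_neg (by simpa using hz), mul_zero]
    · simp
    · intro z _ hz
      rw [pauliOp_elim_apply, if_neg (by simpa using hz.symm), zero_mul]
    · simp
  have hscal : IsScalarOnFirst k W.1ᴴ (W.1ᴴ 0 0) := by
    intro x y hy
    -- Since |y⟩ = X^y|0⟩, W†|y⟩ = X^y W†|0⟩ is the same multiple of |y⟩.
    have h := hcomm (Sum.elim y 0) hy x 0 h0
    rw [Matrix.mul_apply, Matrix.mul_apply, Finset.sum_eq_single 0, Finset.sum_eq_single y] at h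
    · rw [pauliOp_elim_apply, pauliOp_elim_apply, dotProduct_zero, zero_add, if_pos rfl,
        bitSign_zero, mul_one, ite_mul, one_mul, zero_mul] at h
      exact h.symm
    · intro z _ hz
      rw [pauliOp_elim_apply, if_neg (by simpa using hz), mul_zero]
    · simp
    · intro z _ hz
      rw [hcol z hz, mul_zero]
    · simp
  set c := W.1ᴴ 0 0 with hc
  have hWc : W.1 0 0 * c = 1 := by
    rw [← hscal.apply_mul W.1 h0, W.mul_conjTranspose, one_apply_eq]
  have hc0 : c ≠ 0 := fun h => by simp [h] at hWc
  have hnorm : ‖c‖ = 1 := by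
    have h1 : W.1 0 0 = star c := by rw [hc, conjTranspose_apply, star_star]
    rw [h1] at hWc
    have h2 := congrArg norm hWc
    rw [norm_mul, norm_star, norm_one] at h2
    nlinarith [norm_nonneg c]
  refine ⟨W, c⁻¹, by rw [norm_inv, hnorm, inv_one], fun x y hy => ?_, hrep⟩
  have h1 := hscal.apply_mul W.1 (x := x) hy
  rw [W.mul_conjTranspose] at h1
  rw [eq_div_of_mul_eq hc0 h1.symm, one_apply]
  split_ifs <;> simp

/-! ### Group structure -/

theorem freedomSet_mul_mem {n k : ℕ} {F G : Sp n} (hF : F ∈ freedomSet n k)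
    (hG : G ∈ freedomSet n k) : F * G ∈ freedomSet n k := by
  refine hasFreedomShape_iff.2 fun v hv => ?_
  have h1 := hasFreedomShape_iff.1 hG v hv
  have hv' : SupportedOnFirst k fun i => (G.1 *ᵥ v) (Sum.inl i) := fun j hj => by
    change (G.1 *ᵥ v) (Sum.inl j) = 0
    rw [h1.1]
    exact hv j hj
  have h2 := hasFreedomShape_iff.1 hF _ hv'
  rw [Submonoid.coe_mul, ← mulVec_mulVec]
  exact ⟨fun i => (h2.1 i).trans (h1.1 i), fun i hi => (h2.2 i hi).trans (h1.2 i hi)⟩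

theorem one_mem_freedomSet (n k : ℕ) : (1 : Sp n) ∈ freedomSet n k := by
  refine hasFreedomShape_iff.2 fun v _ => ?_
  rw [Submonoid.coe_one, one_mulVec]
  exact ⟨fun _ => rfl, fun _ _ => rfl⟩

/-- The group of freedom matrices. -/
def freedomGroup (n k : ℕ) : Subgroup (Sp n) where
  carrier := freedomSet n k
  one_mem' := one_mem_freedomSet n k
  mul_mem' := freedomSet_mul_mem
  inv_mem' := by
    intro F hF
    -- The symplectic group is finite, so inverses are powers and closure under products suffices.
    have h : F⁻¹ = F ^ (orderOf F - 1) := by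
      rw [inv_eq_iff_mul_eq_one, ← pow_succ', Nat.sub_add_cancel (orderOf_pos F),
        pow_orderOf_eq_one]
    rw [h]
    exact Submonoid.pow_mem (S := ⟨⟨freedomSet n k, freedomSet_mul_mem⟩, one_mem_freedomSet n k⟩)
      hF _

/-! ### Counting freedom matrices -/

/-- Invertible matrices whose first `k` columns are those of the identity. -/
def firstColumnsFixed (n k : ℕ) : Set (Matrix (Fin n) (Fin n) (ZMod 2)) :=
  {P | IsUnit P.det ∧ ∀ i j : Fin n, (j : ℕ) < k → P i j = if i = j then 1 else 0}

/-- Symmetric matrices whose leading `k × k` block vanishes. -/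
def symmZeroBlock (n k : ℕ) : Set (Matrix (Fin n) (Fin n) (ZMod 2)) :=
  {S | Sᵀ = S ∧ ∀ i j : Fin n, (i : ℕ) < k → (j : ℕ) < k → S i j = 0}

theorem transpose_mul_apply_of_firstColumns {n k : ℕ} {P : Matrix (Fin n) (Fin n) (ZMod 2)}
    (hP : ∀ i j : Fin n, (j : ℕ) < k → P i j = if i = j then 1 else 0)
    (X : Matrix (Fin n) (Fin n) (ZMod 2)) {i : Fin n} (hi : (i : ℕ) < k) (j : Fin n) :
    (Pᵀ * X) i j = X i j := by
  simp [Matrix.mul_apply, hP _ i hi]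

/-- Once Y = 0, being symplectic means that PᵀQ is symmetric and PᵀR = 1. The first k rows of Pᵀ are
those of the identity, so Q and PᵀQ share their first k rows, as do R and PᵀR = 1. The shape
condition on R is thus automatic, and the one on Q passes to PᵀQ. -/
theorem fromBlocks_mem_freedomSet_iff {n k : ℕ} {P Y Q R : Matrix (Fin n) (Fin n) (ZMod 2)} :
    (fromBlocks P Y Q R ∈ symplecticGroup (Fin n) (ZMod 2) ∧
      HasFreedomShape k (fromBlocks P Y Q R)) ↔
    P ∈ firstColumnsFixed n k ∧ Pᵀ * Q ∈ symmZeroBlock n k ∧ Y = 0 ∧ R = Pᵀ⁻¹ := by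
  rw [SymplecticGroup.fromBlocks_mem_iff]
  constructor
  · rintro ⟨⟨h1, h2, h3⟩, hxx, hxz, hzx, hzz⟩
    have hY : Y = 0 := by
      ext i j
      exact hxz i j
    subst hY
    rw [Matrix.mul_zero, sub_zero] at h3
    refine ⟨⟨?_, hxx⟩, ⟨?_, fun i j hi hj => ?_⟩, rfl, ?_⟩
    · rw [← det_transpose]
      exact isUnit_det_of_right_inverse h3
    · rw [transpose_mul, transpose_transpose, h1]
    · rw [transpose_mul_apply_of_firstColumns (P := P) hxx _ hi]
      exact hzx i j hi hj
    · exact (inv_eq_right_inv h3).symm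
  · rintro ⟨⟨hdet, hxx⟩, ⟨hsymm, hzero⟩, rfl, rfl⟩
    have h3 : Pᵀ * Pᵀ⁻¹ = 1 := mul_nonsing_inv _ (by rwa [det_transpose])
    refine ⟨⟨?_, by simp, by simp [h3]⟩, hxx, fun i j => rfl, fun i j hi hj => ?_, fun i j hi => ?_⟩
    · rw [← hsymm, transpose_mul, transpose_transpose]
    · rw [fromBlocks_apply₂₁, ← transpose_mul_apply_of_firstColumns hxx Q hi]
      exact hzero i j hi hj
    · rw [fromBlocks_apply₂₂, ← transpose_mul_apply_of_firstColumns hxx Pᵀ⁻¹ hi, h3, one_apply]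

/-- A freedom matrix amounts to an upper left block and a symmetric matrix. -/
noncomputable def freedomEquiv (n k : ℕ) :
    freedomSet n k ≃ firstColumnsFixed n k × symmZeroBlock n k where
  toFun F :=
    have h := fromBlocks_mem_freedomSet_iff.1 (by
      rw [fromBlocks_toBlocks]
      exact ⟨F.1.2, F.2⟩ : fromBlocks F.1.1.toBlocks₁₁ F.1.1.toBlocks₁₂ F.1.1.toBlocks₂₁
        F.1.1.toBlocks₂₂ ∈ symplecticGroup (Fin n) (ZMod 2) ∧ HasFreedomShape k _)
    (⟨F.1.1.toBlocks₁₁, h.1⟩, ⟨F.1.1.toBlocks₁₁ᵀ * F.1.1.toBlocks₂₁, h.2.1⟩)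
  invFun p :=
    have h := fromBlocks_mem_freedomSet_iff.2 ⟨p.1.2, (by
      rw [mul_nonsing_inv_cancel_left _ _ (by rw [det_transpose]; exact p.1.2.1)]
      exact p.2.2 : p.1.1ᵀ * (p.1.1ᵀ⁻¹ * p.2.1) ∈ symmZeroBlock n k), rfl, rfl⟩
    ⟨⟨_, h.1⟩, h.2⟩
  left_inv F := by
    have h := fromBlocks_mem_freedomSet_iff.1 (by
      rw [fromBlocks_toBlocks]
      exact ⟨F.1.2, F.2⟩ : fromBlocks F.1.1.toBlocks₁₁ F.1.1.toBlocks₁₂ F.1.1.toBlocks₂₁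
        F.1.1.toBlocks₂₂ ∈ symplecticGroup (Fin n) (ZMod 2) ∧ HasFreedomShape k _)
    refine Subtype.ext (Subtype.ext ?_)
    conv_rhs => rw [← fromBlocks_toBlocks F.1.1]
    simp only
    rw [nonsing_inv_mul_cancel_left _ _ (by rw [det_transpose]; exact h.1.1), h.2.2.1, h.2.2.2]
  right_inv p := by
    refine Prod.ext (Subtype.ext ?_) (Subtype.ext ?_)
    · simp
    · simp only [toBlocks_fromBlocks₁₁, toBlocks_fromBlocks₂₁]
      rw [mul_nonsing_inv_cancel_left _ _ (by rw [det_transpose]; exact p.1.2.1)]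

theorem reindex_fromBlocks_mem_firstColumnsFixed_iff {k m : ℕ}
    {B : Matrix (Fin k) (Fin k) (ZMod 2)} {a : Matrix (Fin k) (Fin m) (ZMod 2)}
    {b : Matrix (Fin m) (Fin k) (ZMod 2)} {g : Matrix (Fin m) (Fin m) (ZMod 2)} :
    reindex finSumFinEquiv finSumFinEquiv (fromBlocks B a b g) ∈ firstColumnsFixed (k + m) k ↔
      B = 1 ∧ b = 0 ∧ IsUnit g.det := by
  have hcol : (∀ i j : Fin (k + m), (j : ℕ) < k →
      reindex finSumFinEquiv finSumFinEquiv (fromBlocks B a b g) i j = if i = j then 1 else 0) ↔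
      B = 1 ∧ b = 0 := by
    constructor
    · intro h
      constructor
      · ext i j
        have h1 := h (Fin.castAdd m i) (Fin.castAdd m j) j.2
        simpa [one_apply] using h1
      · ext i j
        have h1 := h (Fin.natAdd k i) (Fin.castAdd m j) j.2
        rw [if_neg (fun e => by have := congrArg Fin.val e; simp at this; omega)] at h1
        simpa using h1
    · rintro ⟨rfl, rfl⟩ i j hj
      obtain ⟨j, rfl⟩ : ∃ l : Fin k, j = Fin.castAdd m l := ⟨⟨j, hj⟩, rfl⟩
      induction i using Fin.addCases with
      | left i => simp [one_apply]
      | right i =>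
        rw [if_neg (fun e => by have := congrArg Fin.val e; simp at this; omega)]
        simp
  rw [firstColumnsFixed, Set.mem_ofPred_eq, hcol, det_reindex_self]
  constructor
  · rintro ⟨h, rfl, rfl⟩
    rw [det_fromBlocks_zero₂₁, det_one, one_mul] at h
    exact ⟨rfl, rfl, h⟩
  · rintro ⟨rfl, rfl, h⟩
    rw [det_fromBlocks_zero₂₁, det_one, one_mul]
    exact ⟨h, rfl, rfl⟩

/-- A matrix with fixed first columns amounts to its two blocks in the remaining columns. -/
noncomputable def firstColumnsFixedEquiv (k m : ℕ) :
    Matrix (Fin k) (Fin m) (ZMod 2) × GL (Fin m) (ZMod 2) ≃ firstColumnsFixed (k + m) k :=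
  Equiv.ofBijective
    (fun p => ⟨reindex finSumFinEquiv finSumFinEquiv (fromBlocks 1 p.1 0 p.2.1),
      reindex_fromBlocks_mem_firstColumnsFixed_iff.2
        ⟨rfl, rfl, (isUnit_iff_isUnit_det _).1 p.2.isUnit⟩⟩) <| by
    constructor
    · intro p q h
      have h1 := fromBlocks_inj.1 ((reindex _ _).injective (congrArg Subtype.val h))
      exact Prod.ext h1.2.1 (Units.ext h1.2.2.2)
    · rintro ⟨P, hP⟩
      obtain ⟨X, rfl⟩ := (reindex (finSumFinEquiv (m := k) (n := m)) finSumFinEquiv).surjective P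
      rw [← fromBlocks_toBlocks X] at hP
      obtain ⟨h1, h2, h3⟩ := reindex_fromBlocks_mem_firstColumnsFixed_iff.1 hP
      refine ⟨(X.toBlocks₁₂, GeneralLinearGroup.mk'' _ h3), Subtype.ext ?_⟩
      change reindex _ _ (fromBlocks 1 X.toBlocks₁₂ 0 X.toBlocks₂₂) = reindex _ _ X
      rw [← h1, ← h2, fromBlocks_toBlocks]

theorem card_firstColumnsFixed (k m : ℕ) :
    Nat.card (firstColumnsFixed (k + m) k)
      = 2 ^ (k * m) * ∏ i : Fin m, (2 ^ m - 2 ^ (i : ℕ)) := by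
  rw [← Nat.card_congr (firstColumnsFixedEquiv k m), Nat.card_prod, card_GL_field, ZMod.card]
  congr 1
  simp [Matrix, Nat.card_eq_fintype_card, ← pow_mul, mul_comm]

/-- A symmetric matrix with vanishing leading block is determined by its free upper triangular
entries. -/
def symmZeroBlockEquiv (n k : ℕ) :
    symmZeroBlock n k ≃ ({p : Fin n × Fin n // p.1 ≤ p.2 ∧ k ≤ (p.2 : ℕ)} → ZMod 2) where
  toFun S p := S.1 p.1.1 p.1.2
  invFun f := ⟨of fun i j => if h : k ≤ ((max i j : Fin n) : ℕ) then
    f ⟨(min i j, max i j), min_le_max, h⟩ else 0, by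
      constructor
      · ext i j
        simp only [transpose_apply, of_apply, max_comm j i, min_comm j i]
      · intro i j hi hj
        rw [of_apply, dif_neg]
        rcases max_choice i j with h | h <;> rw [h] <;> omega⟩
  left_inv S := by
    refine Subtype.ext ?_
    ext i j
    simp only [of_apply]
    split_ifs with h
    · rcases le_total i j with hij | hij
      · rw [min_eq_left hij, max_eq_right hij]
      · rw [min_eq_right hij, max_eq_left hij]
        exact congrFun (congrFun S.2.1 i) j
    · have h1 : i ≤ max i j := le_max_left i j
      have h2 : j ≤ max i j := le_max_right i j
      exact (S.2.2 i j (by omega) (by omega)).symm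
  right_inv f := by
    ext ⟨⟨i, j⟩, hij, hj⟩
    simp only [of_apply, max_eq_right hij, min_eq_left hij]
    rw [dif_pos hj]

theorem card_free_entries (k m : ℕ) :
    Fintype.card {p : Fin (k + m) × Fin (k + m) // p.1 ≤ p.2 ∧ k ≤ (p.2 : ℕ)} + k * (k + 1) / 2
      = (k + m) * (k + m + 1) / 2 := by
  rw [Fintype.card_subtype]
  -- Column k + j contains k + j + 1 entries on or above the diagonal.
  have h1 : (Finset.univ.filter fun p : Fin (k + m) × Fin (k + m) =>
      p.1 ≤ p.2 ∧ k ≤ (p.2 : ℕ)).card = ∑ j ∈ Finset.range m, (k + j + 1) := by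
    rw [Finset.card_filter, Fintype.sum_prod_type_right, Fin.sum_univ_add]
    have e1 : ∀ (i : Fin (k + m)) (j : Fin k),
        ¬ (i ≤ Fin.castAdd m j ∧ k ≤ ((Fin.castAdd m j : Fin (k + m)) : ℕ)) := fun i j h => by
      have := h.2
      simp at this
      omega
    simp only [e1, if_false, Finset.sum_const_zero, zero_add]
    rw [Finset.sum_range]
    refine Finset.sum_congr rfl fun j _ => ?_
    have e2 : ∀ i : Fin (k + m), (i ≤ Fin.natAdd k j ∧ k ≤ ((Fin.natAdd k j : Fin (k + m)) : ℕ)) ↔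
        i ∈ Finset.Iic (Fin.natAdd k j) := fun i => by simp
    simp only [e2]
    rw [← Finset.card_filter, Finset.filter_univ_mem, Fin.card_Iic]
    simp
  rw [h1]
  have h2 : ∀ m : ℕ, 2 * ∑ j ∈ Finset.range m, (k + j + 1) + k * (k + 1)
      = (k + m) * (k + m + 1) := fun m => by
    induction m with
    | zero => simp
    | succ m ih => rw [Finset.sum_range_succ]; linarith
  have h3 := h2 m
  -- Evenness makes the truncated halves exact.
  have h4 := Nat.even_mul_succ_self k
  obtain ⟨a, ha⟩ := h4
  omega

theorem card_symmZeroBlock (k m : ℕ) :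
    Nat.card (symmZeroBlock (k + m) k) * 2 ^ (k * (k + 1) / 2)
      = 2 ^ ((k + m) * (k + m + 1) / 2) := by
  rw [Nat.card_congr (symmZeroBlockEquiv _ _), Nat.card_eq_fintype_card, Fintype.card_fun,
    ZMod.card, ← pow_add, card_free_entries]

theorem ncard_freedomSet {n k : ℕ} (hk : k ≤ n) : ((freedomSet n k).ncard : ℚ) =
    2 ^ (n * (n + 1) / 2 + k * (n - k)) / 2 ^ (k * (k + 1) / 2) *
      ∏ m ∈ Finset.Icc 1 (n - k), ((2 : ℚ) ^ (n - k) - 2 ^ (m - 1)) := by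
  obtain ⟨m, rfl⟩ := Nat.exists_eq_add_of_le hk
  rw [Nat.add_sub_cancel_left, ← Nat.card_coe_set_eq, Nat.card_congr (freedomEquiv _ _),
    Nat.card_prod, card_firstColumnsFixed]
  have h1 := congrArg (Nat.cast (R := ℚ)) (card_symmZeroBlock k m)
  push_cast at h1
  have h2 : ((∏ i : Fin m, (2 ^ m - 2 ^ (i : ℕ)) : ℕ) : ℚ)
      = ∏ i ∈ Finset.Icc 1 m, ((2 : ℚ) ^ m - 2 ^ (i - 1)) := by
    rw [Nat.cast_prod, ← Finset.Ico_add_one_right_eq_Icc, Finset.prod_Ico_eq_prod_range,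
      Nat.add_sub_cancel, Finset.prod_range]
    refine Finset.prod_congr rfl fun i _ => ?_
    rw [Nat.cast_sub (Nat.pow_le_pow_right two_pos i.2.le), Nat.add_sub_cancel_left]
    push_cast
    rfl
  rw [Nat.cast_mul, Nat.cast_mul, h2, pow_add, ← h1]
  push_cast
  field_simp

/-! ### Reduction to the trivial gate -/

theorem theorem1 (n k : ℕ) (hk : k ≤ n)
    (L : Submodule ℂ (Bits n → ℂ)) (hL : IsStabilizerCode n k L)
    (UE : QUnitary n) (hUE : UE ∈ cliffordGroup n) (hEnc : IsEncoder hk L UE)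
    (UC : QUnitary k) (hUC : UC ∈ cliffordGroup k)
    (E : Sp n) (hE : SympRepresents (UE : Matrix (Bits n) (Bits n) ℂ) E)
    (C' : Sp n) (hC' : SympRepresents (tensorOne hk (UC : Matrix (Bits k) (Bits k) ℂ)) C') :
    (∀ U ∈ cliffordGroup n, Implements hk UE UC U →
      ∃! F : Sp n, F ∈ freedomSet n k ∧
        SympRepresents (U : Matrix (Bits n) (Bits n) ℂ) (E * C' * F * E⁻¹)) ∧
    (∀ F ∈ freedomSet n k, ∃ U ∈ cliffordGroup n, Implements hk UE UC U ∧
      SympRepresents (U : Matrix (Bits n) (Bits n) ℂ) (E * C' * F * E⁻¹)) ∧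
    (∃ G : Subgroup (Sp n), (G : Set (Sp n)) = freedomSet n k) ∧
    ((freedomSet n k).ncard : ℚ) =
      2 ^ (n * (n + 1) / 2 + k * (n - k)) / 2 ^ (k * (k + 1) / 2) *
        ∏ m ∈ Finset.Icc 1 (n - k), ((2 : ℚ) ^ (n - k) - 2 ^ (m - 1)) := by
  set V : QUnitary n := tensorOneUnitary hk UC with hVdef
  have hV : SympRepresents V.1 C' := hC'
  have hVψ : ∀ ψ, V.1 *ᵥ tensorZero hk ψ = tensorZero hk (UC.1 *ᵥ ψ) :=
    tensorOne_mulVec_tensorZero hk UC.1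
  refine ⟨fun U hU ⟨c, _, hc⟩ => ?_, fun F hF => ?_, ⟨freedomGroup n k, rfl⟩,
    ncard_freedomSet hk⟩
  · obtain ⟨A, hA⟩ := exists_sympRepresents hU
    -- Undoing the encoding and the gate leaves an operator that is the phase c on |ψ⟩ ⊗ |0⟩; its
    -- matrix is the required F.
    have hrep : SympRepresents (V⁻¹ * UE⁻¹ * U * UE : QUnitary n).1 (C'⁻¹ * E⁻¹ * A * E) :=
      ((hV.conjTranspose.mul hE.conjTranspose).mul hA).mul hE
    have hscal : IsScalarOnFirst k (V⁻¹ * UE⁻¹ * U * UE : QUnitary n).1 c := by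
      refine (isScalarOnFirst_iff hk).2 fun ψ => ?_
      have h := hc ψ
      rw [encode, encode, ← hVψ] at h
      change (V.1ᴴ * UE.1ᴴ * U.1 * UE.1) *ᵥ _ = _
      rw [← mulVec_mulVec, ← mulVec_mulVec, h, mulVec_smul, mulVec_mulVec, mulVec_mulVec,
        Matrix.mul_assoc V.1ᴴ, UE.conjTranspose_mul, Matrix.mul_one, V.conjTranspose_mul,
        one_mulVec]
    refine ⟨_, ⟨hscal.mem_freedomSet hrep, ?_⟩, fun F hF => ?_⟩
    · convert hA using 1
      group
    -- U determines its symplectic matrix, and F is recovered from E C' F E⁻¹ by cancellation.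
    · have h := hF.2.unique hA
      rw [← h]
      group
  · obtain ⟨W, c, hc, hscal, hW⟩ := exists_isScalarOnFirst hF
    have hrep : SympRepresents (UE * V * W * UE⁻¹ : QUnitary n).1 (E * C' * F * E⁻¹) :=
      ((hE.mul hV).mul hW).mul hE.conjTranspose
    refine ⟨UE * V * W * UE⁻¹, hrep.mem_cliffordGroup, ⟨c, hc, fun ψ => ?_⟩, hrep⟩
    rw [encode, encode, ← hVψ]
    change (UE.1 * V.1 * W.1 * UE.1ᴴ) *ᵥ _ = _
    rw [mulVec_mulVec, Matrix.mul_assoc _ UE.1ᴴ, UE.conjTranspose_mul, Matrix.mul_one,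
      ← mulVec_mulVec, (isScalarOnFirst_iff hk).1 hscal, mulVec_smul, ← mulVec_mulVec]
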